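/- **Problem.** Let $\mathcal S\subseteq\mathbb R^d$ be nonempty, convex and compact, let $\mathcal V\subseteq\mathbb R^m$ be nonempty, closed and convex, let $\|\cdot\|$ be a norm on $\mathbb R^m$ with dual norm $\|\cdot\|_*$, and let $u:\mathbb R^m\to\mathbb R$ be concave and Lipschitz with $u(0)=0$. Put $d_{\mathcal V}(v)=\inf_{\tilde v\in\mathcal V}\|\tilde v-v\|$. Let $\mathbb P$ be a distribution of $(x,\mu)=(x,(r,V))\in\mathbb R^p\times(\mathbb R^d\times\mathbb R^{d\times m})$ with $r,V$ integrable, and let $g^*(x)=\mathbb E[\mu\mid x]$. For a measurable policy $\pi:\mathbb R^p\to\mathcal S$ let $\mathrm{rew}(\pi)=\mathbb E[r^T\pi(x)]$ and $\mathrm{con}(\pi)=\mathbb E[V^T\pi(x)]$. Let $\mathrm{OPT}$ and $\mathrm{OPT}^\epsilon$ be the suprema of $\mathrm{rew}(\pi)+u(\mathrm{con}(\pi))$ over the policies with $\mathrm{con}(\pi)\in\mathcal V$, respectively $d_{\mathcal V}(\mathrm{con}(\pi))\le\epsilon$. Let $\Lambda$ and $\Theta$ be the domains of the Fenchel conjugates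 $(-u)^*$ and $d_{\mathcal V}^*$. **Algorithm.** Fix $\zeta>0$. For $\omega=(\lambda,\theta)$ put $c(\mu;\omega)=r-V\lambda-\zeta V\theta$, and let $w^*(\mu;\omega)\in\arg\max_{w\in\mathcal S}c(\mu;\omega)^Tw$ be a measurable optimization oracle, for $\omega\in\Lambda\times\Theta$. Put $R_{\rm SPO}(g;\omega)=\mathbb E[c(\mu;\omega)^T(w^*(\mu;\omega)-w^*(g(x);\omega))]$. Let $\ell$ be a real function of two cost vectors, $\mathcal H$ a class of measurable predictors, and let an empirical risk minimization rule choose, for every sample of size $n\ge1$ and every $\omega\in\Lambda\times\Theta$, a predictor $\hat g^n_\omega\in\arg\min_{g\in\mathcal H}\sum_{i\le n}\ell\big(c(g(x_i);\omega),c(\mu_i;\omega)\big)$. Let $h_\Lambda,h_\Theta$ be differentiable and $1$-strongly convex with respect to $\|\cdot\|_*$ on $\Lambda,\Theta$, with Bregman distances $B_{h_\Lambda}\le D_\Lambda$ and $B_{h_\Theta}\le D_\Theta$, where $D_\Lambda,D_\Theta>0$, and let $G_\Lambda,G_\Theta>0$. With horizon $T$ the algorithm draws $(x_t,\mu_t)$,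 $t=1,\dots,T$, i.i.d. from $\mathbb P$. It starts from any $\lambda_1\in\Lambda$, $\theta_1\in\Theta$ and any measurable predictor $g_1$. In round $t$ it takes $w_t=w^*(g_t(x_t);(\lambda_t,\theta_t))$ and consumes $v_t=V_t^Tw_t$; then it sets $$\lambda_{t+1}\in\arg\min_{\lambda\in\Lambda}\{\eta_\lambda q_t^T\lambda+B_{h_\Lambda}(\lambda,\lambda_t)\},\qquad \theta_{t+1}\in\arg\min_{\theta\in\Theta}\{\eta_\theta {q_t'}^T\theta+B_{h_\Theta}(\theta,\theta_t)\},$$ where $q_t$ is a subgradient at $\lambda_t$ of $\lambda\mapsto-v_t^T\lambda+(-u)^*(\lambda)$ on $\Lambda$ with $\|q_t\|\le G_\Lambda$, $q_t'$ is a subgradient at $\theta_t$ of $\theta\mapsto-v_t^T\theta+d_{\mathcal V}^*(\theta)$ on $\Theta$ with $\|q'_t\|\le G_\Theta$, $\eta_\lambda=\sqrt{D_\Lambda}/(G_\Lambda\sqrt T)$ and $\eta_\theta=\sqrt{D_\Theta}/(G_\Theta\sqrt T)$; finally $g_{t+1}=\hat g^{t}_{(\lambda_{t+1},\theta_{t+1})}$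 for the sample $(x_s,\mu_s)_{s\le t}$. Put $r_{\rm avg}=\frac1T\sum_{t\le T}r_t^Tw_t$ and $v_{\rm avg}=\frac1T\sum_{t\le T}v_t$. **Assumptions.** 1. There are $\kappa_{\rm risk},\alpha>0$ with $\mathbb E\big[\sup_{\omega\in\Lambda\times\Theta}\{R_{\rm SPO}(\hat g^n_\omega;\omega)-R_{\rm SPO}(g^*;\omega)\}\big]\le\kappa_{\rm risk}n^{-\alpha}$ for all $n\ge1$, the expectation being over $n$ i.i.d. samples from $\mathbb P$. 2. There is $D_v\ge1$ such that for every $w\in\mathcal S$, $\|V^Tw\|\le D_v$ almost surely. Put $\kappa_{\rm MD}=D_v(\zeta\sqrt{D_\Theta}+\sqrt{D_\Lambda})$. 3. There is $\zeta_{\rm OPT}\in\mathbb R$ with $\mathrm{OPT}^\epsilon\le\mathrm{OPT}+\zeta_{\rm OPT}\,\epsilon$ for all $\epsilon>0$. **Theorem.** For every $K$ there is a constant $C>0$, depending only on $K$, such that for every problem and algorithm as above that satisfy Assumptions 1–3 and $\max(G_\Lambda,G_\Theta)\le K D_v$ there are numbers $c_T$ ($T\ge1$), depending on these data and on $T$ but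 not on the run of the algorithm (in particular not on its initialization), with $c_T\le C$ for all sufficiently large $T$, such that every run of the algorithm with any horizon $T\ge1$ satisfies $$\mathrm{OPT}-\mathbb E[r_{\rm avg}+u(v_{\rm avg})]\le\kappa_{\rm MD}\,c_T\,T^{-1/2}+\kappa_{\rm risk}\,c_T\,T^{-\alpha},$$ and, if in addition $\zeta\ge2\Big(\zeta_{\rm OPT}+\frac{\sqrt{D_\Lambda}}{\sqrt{D_\Theta}}+\frac{\kappa_{\rm risk}}{D_v\sqrt{D_\Theta}}\Big)$, then also $$\mathbb E[d_{\mathcal V}(v_{\rm avg})]\le D_v\sqrt{D_\Theta}\,c_T\,T^{-1/2}+D_v\sqrt{D_\Theta}\,c_T\,T^{-\alpha}.$$ -/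

import Mathlib

open MeasureTheory ProbabilityTheory Filter
open scoped Matrix ENNReal

noncomputable section

namespace OnlineSPO

/-- Vectors of `ℝⁿ`. -/
abbrev Vec (n : ℕ) : Type := Fin n → ℝ

/-- Pairs `μ = (r, V)` of a reward vector and a consumption matrix. -/
abbrev Coeff (d m : ℕ) : Type := Vec d × (Fin d → Fin m → ℝ)

/-- One observation `(x, μ) = (x, (r, V))`. -/
abbrev Obs (p d m : ℕ) : Type := Vec p × Coeff d m

/-! ### Convex analysis on `ℝᵐ` with a generic norm -/

/-- The dual norm `‖y‖_* = max { yᵀ v : ‖v‖ ≤ 1 }`. -/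
def dualNorm {m : ℕ} (nrm : Seminorm ℝ (Vec m)) (y : Vec m) : ℝ :=
  sSup ((fun v => y ⬝ᵥ v) '' {v | nrm v ≤ 1})

/-- The distance from `v` to the set `A`, measured in the given norm. -/
def distTo {m : ℕ} (nrm : Seminorm ℝ (Vec m)) (A : Set (Vec m)) (v : Vec m) : ℝ :=
  sInf ((fun a => nrm (a - v)) '' A)

/-- The domain of the Fenchel conjugate of `f`: the points where the supremum is finite. -/
def conjDom {m : ℕ} (f : Vec m → ℝ) : Set (Vec m) :=
  {y | BddAbove (Set.range fun v => y ⬝ᵥ v - f v)}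

/-- The Fenchel conjugate `f^*(y) = sup_v (yᵀ v - f v)`; only used for `y ∈ conjDom f`. -/
def conj {m : ℕ} (f : Vec m → ℝ) (y : Vec m) : ℝ :=
  ⨆ v, (y ⬝ᵥ v - f v)

/-- `q` is a subgradient at `y` of the convex function `f` with domain `D`. -/
def IsSubgradientOn {m : ℕ} (D : Set (Vec m)) (f : Vec m → ℝ) (y q : Vec m) : Prop :=
  ∀ y' ∈ D, f y + q ⬝ᵥ (y' - y) ≤ f y'

/-- The Bregman distance of `h`, whose gradient is `dh`. -/
def bregman {m : ℕ} (h : Vec m → ℝ) (dh : Vec m → Vec m) (y₁ y₂ : Vec m) : ℝ :=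
  h y₁ - h y₂ - dh y₂ ⬝ᵥ (y₁ - y₂)

/-- `h` is differentiable on `D` with gradient `dh`, and it is `1`-strongly convex on `D` with
respect to the dual norm (first-order form of strong convexity). -/
structure IsMirrorMap {m : ℕ} (nrm : Seminorm ℝ (Vec m)) (D : Set (Vec m))
    (h : Vec m → ℝ) (dh : Vec m → Vec m) : Prop where
  hasGradient : ∀ y ∈ D, ∃ f' : Vec m →L[ℝ] ℝ,
    (∀ v, f' v = dh y ⬝ᵥ v) ∧ HasFDerivWithinAt h f' D y
  stronglyConvex : ∀ y₁ ∈ D, ∀ y₂ ∈ D,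
    h y₂ + dh y₂ ⬝ᵥ (y₁ - y₂) + 1 / 2 * dualNorm nrm (y₁ - y₂) ^ 2 ≤ h y₁

/-- `y'` is the result of a mirror descent step with step size `η` and subgradient `q`:
`y' ∈ argmin_{y'' ∈ D} { η qᵀ y'' + B_h(y'', y) }`. -/
def IsMirrorStep {m : ℕ} (D : Set (Vec m)) (h : Vec m → ℝ) (dh : Vec m → Vec m)
    (η : ℝ) (q y y' : Vec m) : Prop :=
  y' ∈ D ∧ IsMinOn (fun y'' => η * (q ⬝ᵥ y'') + bregman h dh y'' y) D y'

/-! ### The decision problem -/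

/-- The data of the online contextual convex problem, with its standing assumptions. -/
structure Problem (p d m : ℕ) where
  /-- the feasible region of the decisions -/
  S : Set (Vec d)
  S_nonempty : S.Nonempty
  S_convex : Convex ℝ S
  S_compact : IsCompact S
  /-- the norm on the consumption space -/
  nrm : Seminorm ℝ (Vec m)
  nrm_definite : ∀ v, nrm v = 0 → v = 0
  /-- the feasible region of the average consumption -/
  feas : Set (Vec m)
  feas_nonempty : feas.Nonempty
  feas_convex : Convex ℝ feas
  feas_closed : IsClosed feas
  /-- the utility function, and a Lipschitz constant of it -/
  u : Vec m → ℝ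
  L : ℝ
  u_lipschitz : ∀ v v', |u v - u v'| ≤ L * nrm (v - v')
  u_concave : ConcaveOn ℝ Set.univ u
  u_zero : u 0 = 0
  /-- the law of `(x, (r, V))` -/
  P : Measure (Obs p d m)
  P_prob : IsProbabilityMeasure P
  r_integrable : ∀ i, Integrable (fun z : Obs p d m => z.2.1 i) P
  V_integrable : ∀ i j, Integrable (fun z : Obs p d m => z.2.2 i j) P

attribute [instance] Problem.P_prob

/-- The consumption `Vᵀ w`. -/
def consume {d m : ℕ} (V : Fin d → Fin m → ℝ) (w : Vec d) : Vec m := (Matrix.of V)ᵀ *ᵥ w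

/-- The linear cost vector `r - V λ - ζ V θ`, where `ω = (λ, θ)`. -/
def cost {d m : ℕ} (ζ : ℝ) (μ : Coeff d m) (ω : Vec m × Vec m) : Vec d :=
  μ.1 - Matrix.of μ.2 *ᵥ ω.1 - ζ • (Matrix.of μ.2 *ᵥ ω.2)

namespace Problem

variable {p d m : ℕ} (Q : Problem p d m)

/-- The distance to feasibility. -/
def dist (v : Vec m) : ℝ := distTo Q.nrm Q.feas v

/-- The domain `Λ` of the conjugate of `-u`. -/
def Lam : Set (Vec m) := conjDom fun v => -Q.u v

/-- The domain `Θ` of the conjugate of the distance function. -/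
def Tht : Set (Vec m) := conjDom Q.dist

/-- `ξ(λ) = -vᵀ λ + (-u)^*(λ)`. -/
def xi (v lam : Vec m) : ℝ := -(v ⬝ᵥ lam) + conj (fun v => -Q.u v) lam

/-- `φ(θ) = -vᵀ θ + d^*(θ)`, where `d` is the distance to feasibility. -/
def phi (v tht : Vec m) : ℝ := -(v ⬝ᵥ tht) + conj Q.dist tht

/-- The (measurable) static policies `π : ℝᵖ → S`. -/
def policies : Set (Vec p → Vec d) := {π | Measurable π ∧ ∀ x, π x ∈ Q.S}

/-- The expected reward of a static policy. -/
def rew (π : Vec p → Vec d) : ℝ := ∫ z, z.2.1 ⬝ᵥ π z.1 ∂Q.P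

/-- The expected consumption of a static policy. -/
def con (π : Vec p → Vec d) : Vec m := fun j => ∫ z, consume z.2.2 (π z.1) j ∂Q.P

/-- The value of the best feasible static policy (`⊥` if there is none). -/
def OPT : EReal :=
  ⨆ π ∈ {π ∈ Q.policies | Q.con π ∈ Q.feas}, ((Q.rew π + Q.u (Q.con π) : ℝ) : EReal)

/-- The value of the best static policy whose expected consumption is `ε`-close to feasible. -/
def OPTrelax (ε : ℝ) : EReal :=
  ⨆ π ∈ {π ∈ Q.policies | Q.dist (Q.con π) ≤ ε}, ((Q.rew π + Q.u (Q.con π) : ℝ) : EReal)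

/-- The ground truth predictor `g^*(x) = E[(r, V) | x]`, through the conditional law given `x`. -/
def gstar (x : Vec p) : Coeff d m :=
  (fun i => ∫ μ, μ.1 i ∂(Q.P.condKernel x), fun i j => ∫ μ, μ.2 i j ∂(Q.P.condKernel x))

end Problem

/-! ### The algorithm -/

/-- The parameters of the algorithm: penalty, optimization oracle, surrogate loss, hypothesis
class, empirical risk minimization rule, mirror maps, and the constants in the step sizes. -/
structure Method {p d m : ℕ} (Q : Problem p d m) where
  /-- the budget penalty parameter -/
  ζ : ℝ
  ζ_pos : 0 < ζ
  /-- the optimization oracle `w^*(μ; ω)` -/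
  oracle : Coeff d m → Vec m × Vec m → Vec d
  oracle_measurable : Measurable fun q : Coeff d m × (Vec m × Vec m) => oracle q.1 q.2
  oracle_spec : ∀ μ, ∀ ω ∈ Q.Lam ×ˢ Q.Tht,
    oracle μ ω ∈ Q.S ∧ IsMaxOn (fun w => cost ζ μ ω ⬝ᵥ w) Q.S (oracle μ ω)
  /-- the surrogate loss `ℓ(ĉ, c)` on cost vectors -/
  loss : Vec d → Vec d → ℝ
  /-- the hypothesis class -/
  hyp : Set (Vec p → Coeff d m)
  hyp_measurable : ∀ g ∈ hyp, Measurable g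
  /-- the empirical risk minimization rule: sample and dual variables give a predictor -/
  erm : (n : ℕ) → (Fin n → Obs p d m) → Vec m × Vec m → Vec p → Coeff d m
  erm_spec : ∀ n, 0 < n → ∀ (s : Fin n → Obs p d m), ∀ ω ∈ Q.Lam ×ˢ Q.Tht,
    erm n s ω ∈ hyp ∧
      IsMinOn (fun g => ∑ i, loss (cost ζ (g (s i).1) ω) (cost ζ (s i).2 ω)) hyp (erm n s ω)
  /-- the mirror maps on `Λ` and on `Θ`, with their gradients -/
  hLam : Vec m → ℝ
  dhLam : Vec m → Vec m
  hLam_spec : IsMirrorMap Q.nrm Q.Lam hLam dhLam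
  hTht : Vec m → ℝ
  dhTht : Vec m → Vec m
  hTht_spec : IsMirrorMap Q.nrm Q.Tht hTht dhTht
  /-- upper bounds on the Bregman distances -/
  DLam : ℝ
  DLam_pos : 0 < DLam
  DLam_spec : ∀ y₁ ∈ Q.Lam, ∀ y₂ ∈ Q.Lam, bregman hLam dhLam y₁ y₂ ≤ DLam
  DTht : ℝ
  DTht_pos : 0 < DTht
  DTht_spec : ∀ y₁ ∈ Q.Tht, ∀ y₂ ∈ Q.Tht, bregman hTht dhTht y₁ y₂ ≤ DTht
  /-- upper bounds on the norms of the subgradients used in the dual updates -/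
  GLam : ℝ
  GLam_pos : 0 < GLam
  GTht : ℝ
  GTht_pos : 0 < GTht

namespace Method

variable {p d m : ℕ} {Q : Problem p d m} (M : Method Q)

/-- The SPO loss `(r - V λ - ζ V θ)ᵀ (w^*(μ; ω) - w^*(μ̂; ω))`. -/
def spoLoss (μhat μ : Coeff d m) (ω : Vec m × Vec m) : ℝ :=
  cost M.ζ μ ω ⬝ᵥ (M.oracle μ ω - M.oracle μhat ω)

/-- The expected SPO risk. -/
def spoRisk (g : Vec p → Coeff d m) (ω : Vec m × Vec m) : ℝ :=
  ∫ z, M.spoLoss (g z.1) z.2 ω ∂Q.P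

/-- Risk bound: for each sample size `n > 0`, the expectation over `n` i.i.d. observations of
`sup_{ω ∈ Λ × Θ}` of the excess SPO risk of the empirical surrogate risk minimizer for `ω` is at
most `κ n^{-α}`. -/
def RiskBound (κ α : ℝ) : Prop :=
  ∀ n : ℕ, 0 < n →
    ∫⁻ s, ⨆ ω ∈ Q.Lam ×ˢ Q.Tht, ENNReal.ofReal (M.spoRisk (M.erm n s ω) ω - M.spoRisk Q.gstar ω)
        ∂(Measure.pi fun _ : Fin n => Q.P)
      ≤ ENNReal.ofReal (κ * (n : ℝ) ^ (-α))

end Method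

/-- Bounded consumption: `D ≥ 1`, and for each `w ∈ S`, almost surely `‖Vᵀ w‖ ≤ D`. -/
def BoundedConsumption {p d m : ℕ} (Q : Problem p d m) (D : ℝ) : Prop :=
  1 ≤ D ∧ ∀ w ∈ Q.S, ∀ᵐ z ∂Q.P, Q.nrm (consume z.2.2 w) ≤ D

/-- Relaxing feasibility by `ε` raises the optimal value by at most `ζopt * ε`. -/
def RelaxBound {p d m : ℕ} (Q : Problem p d m) (ζopt : ℝ) : Prop :=
  ∀ ε : ℝ, 0 < ε → Q.OPTrelax ε ≤ Q.OPT + ((ζopt * ε : ℝ) : EReal)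

/-- The first `t` of `T` observations. -/
def past {Z : Type} {t T : ℕ} (ht : t ≤ T) (z : Fin T → Z) : Fin t → Z :=
  fun i => z (Fin.castLE ht i)

/-- The dual variables, as functions of the history (with `t` past observations), and the initial
predictor. Rounds are numbered from `0`, so round `t` has `t` past observations. -/
structure Trajectory (p d m : ℕ) where
  lam : (t : ℕ) → (Fin t → Obs p d m) → Vec m
  tht : (t : ℕ) → (Fin t → Obs p d m) → Vec m
  g₀ : Vec p → Coeff d m

namespace Trajectory

variable {p d m : ℕ} {Q : Problem p d m} (A : Trajectory p d m) (M : Method Q)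

/-- The predictor of round `t`: the initial one, then the empirical risk minimizer on all past
observations for the current dual variables. -/
def pred : (t : ℕ) → (Fin t → Obs p d m) → Vec p → Coeff d m
  | 0, _ => A.g₀
  | t + 1, s => M.erm (t + 1) s (A.lam (t + 1) s, A.tht (t + 1) s)

/-- The decision `w` of round `t` among `T`, when the observations are `z`. It depends only on the
past observations and on the current context. -/
def decision {T : ℕ} (z : Fin T → Obs p d m) (t : Fin T) : Vec d :=
  M.oracle (A.pred M t (past t.2.le z) (z t).1)
    (A.lam t (past t.2.le z), A.tht t (past t.2.le z))

/-- The consumption `v` of round `t`. -/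
def consumption {T : ℕ} (z : Fin T → Obs p d m) (t : Fin T) : Vec m :=
  consume (z t).2.2 (A.decision M z t)

/-- The average reward. -/
def rAvg {T : ℕ} (z : Fin T → Obs p d m) : ℝ :=
  1 / (T : ℝ) * ∑ t, (z t).2.1 ⬝ᵥ A.decision M z t

/-- The average consumption. -/
def vAvg {T : ℕ} (z : Fin T → Obs p d m) : Vec m :=
  (1 / (T : ℝ)) • ∑ t, A.consumption M z t

/-- `A` is a run of the algorithm with horizon `T`: it starts at points of `Λ` and `Θ`, and in
each round both dual variables make a mirror descent step, with step sizes `√D / (G √T)`, along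
some subgradient of `ξ_t`, respectively `φ_t`, of norm at most `G`. -/
structure IsRun (T : ℕ) : Prop where
  g₀_measurable : Measurable A.g₀
  lam_measurable : ∀ t ≤ T, Measurable (A.lam t)
  tht_measurable : ∀ t ≤ T, Measurable (A.tht t)
  pred_measurable : ∀ t < T,
    Measurable fun q : (Fin t → Obs p d m) × Vec p => A.pred M t q.1 q.2
  lam_init : ∀ s, A.lam 0 s ∈ Q.Lam
  tht_init : ∀ s, A.tht 0 s ∈ Q.Tht
  lam_step : ∀ t : Fin T, ∀ᵐ z ∂(Measure.pi fun _ : Fin T => Q.P), ∃ q,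
    IsSubgradientOn Q.Lam (Q.xi (A.consumption M z t)) (A.lam t (past t.2.le z)) q ∧
    Q.nrm q ≤ M.GLam ∧
    IsMirrorStep Q.Lam M.hLam M.dhLam (√M.DLam / (M.GLam * √(T : ℝ))) q
      (A.lam t (past t.2.le z)) (A.lam (t + 1) (past (Nat.succ_le_of_lt t.2) z))
  tht_step : ∀ t : Fin T, ∀ᵐ z ∂(Measure.pi fun _ : Fin T => Q.P), ∃ q,
    IsSubgradientOn Q.Tht (Q.phi (A.consumption M z t)) (A.tht t (past t.2.le z)) q ∧
    Q.nrm q ≤ M.GTht ∧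
    IsMirrorStep Q.Tht M.hTht M.dhTht (√M.DTht / (M.GTht * √(T : ℝ))) q
      (A.tht t (past t.2.le z)) (A.tht (t + 1) (past (Nat.succ_le_of_lt t.2) z))

end Trajectory

/-- `κ_MD = D_v (ζ √D_Θ + √D_Λ)`. -/
def kappaMD {p d m : ℕ} {Q : Problem p d m} (M : Method Q) (Dv : ℝ) : ℝ :=
  Dv * (M.ζ * √M.DTht + √M.DLam)

end OnlineSPO

end

/-! The dual variables linearize the concave objective and the distance penalty. By Fenchel duality
`u(v)` is the minimum over `Λ` of `(-u)^*(λ) - vᵀλ`, and `-d(v)` is the analogous minimum over `Θ`.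
Regret of mirror descent against the minimizers at the realized `v_avg` therefore compares the sum
of linearized losses directly with `u(v_avg) - ζ d(v_avg)`, at cost `O(√T)` (`mirror_regret_conj`,
`pathwise_bound`).

Conditionally on the past, the predictor and the dual variables of a round are fixed and the new
observation is independent of them. The oracle applied to `g^*` maximizes the conditional expected
linear cost, so the decision of the round loses at most the excess SPO risk against any static
policy (`policy_le_excess_risk`, `rew_le_round`). This loss is at most `κ t^{-α}` after `t ≥ 1`
observations, and at most a constant `B` in the initial round.

Summing the rounds gives `lagrangian_bound`: with `X` the expected value of the run, `ε` its
expected distance to feasibility and `err` the averaged errors, every policy has penalized value at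
most `X - ζ ε + err`. Feasible policies yield `OPT ≤ X - ζ ε + err`, hence the first claim.
Conversely, averaging the decisions over the randomness and over the rounds gives a static policy,
and Jensen's inequality gives `X ≤ OPT^ε ≤ OPT + ζ_OPT ε` for `ε > 0` (`value_le_OPTrelax`).
Together, `(ζ - ζ_OPT) ε ≤ err`, which is the second claim once `ζ` is large. -/

namespace OnlineSPO

/-! ### Norms on `ℝᵐ` -/

section Norms

variable {m : ℕ}

lemma seminorm_le_sum (nrm : Seminorm ℝ (Vec m)) (v : Vec m) :
    nrm v ≤ ∑ j, |v j| * nrm (Pi.single j 1) := by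
  conv_lhs => rw [pi_eq_sum_univ' v]
  refine (Finset.le_sum_of_subadditive nrm (map_zero nrm).le (map_add_le_add nrm) _ _).trans
    (Finset.sum_le_sum fun j _ => ?_)
  rw [map_smul_eq_mul, Real.norm_eq_abs]

lemma seminorm_continuous (nrm : Seminorm ℝ (Vec m)) : Continuous nrm :=
  continuousOn_univ.1 (nrm.convexOn.continuousOn isOpen_univ)

/-- By compactness, the continuous function `nrm` has a minimum on the unit sphere of the sup norm,
positive by definiteness. The sphere is empty when `m = 0`. -/
lemma exists_norm_le_seminorm (nrm : Seminorm ℝ (Vec m)) (hd : ∀ v, nrm v = 0 → v = 0) :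
    ∃ c : ℝ, 0 < c ∧ ∀ v, ‖v‖ ≤ c * nrm v := by
  rcases (Metric.sphere (0 : Vec m) 1).eq_empty_or_nonempty with he | hne
  · refine ⟨1, one_pos, fun v => ?_⟩
    by_cases hv : v = 0
    · simp [hv]
    · exfalso
      have : ‖v‖⁻¹ • v ∈ Metric.sphere (0 : Vec m) 1 := by
        simp [norm_smul, norm_ne_zero_iff.2 hv]
      simp [he] at this
  · obtain ⟨a, ha, hmin⟩ := (isCompact_sphere (0 : Vec m) 1).exists_isMinOn hne
      (seminorm_continuous nrm).continuousOn
    have ha0 : a ≠ 0 := by rintro rfl; simp at ha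
    have hpos : 0 < nrm a := lt_of_le_of_ne (apply_nonneg nrm a) fun h => ha0 (hd a h.symm)
    refine ⟨(nrm a)⁻¹, inv_pos.2 hpos, fun v => ?_⟩
    by_cases hv : v = 0
    · simp [hv]
    have hv' : 0 < ‖v‖ := norm_pos_iff.2 hv
    have h1 : nrm a ≤ nrm (‖v‖⁻¹ • v) := hmin (by simp [norm_smul, hv'.ne'])
    rw [map_smul_eq_mul, norm_inv, norm_norm] at h1
    rw [inv_mul_eq_div, le_div_iff₀ hpos]
    calc ‖v‖ * nrm a ≤ ‖v‖ * (‖v‖⁻¹ * nrm v) := by gcongr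
      _ = nrm v := by field_simp

lemma abs_dotProduct_le (y v : Vec m) : |y ⬝ᵥ v| ≤ (∑ j, |y j|) * ‖v‖ := by
  rw [dotProduct, Finset.sum_mul]
  refine (Finset.abs_sum_le_sum_abs _ _).trans (Finset.sum_le_sum fun j _ => ?_)
  rw [abs_mul]
  gcongr
  exact norm_le_pi_norm v j

/-- Definiteness bounds the set whose supremum is `dualNorm`, so that `sSup` is a genuine supremum;
the rest is rescaling `v` to norm one. -/
lemma dotProduct_le_dualNorm (nrm : Seminorm ℝ (Vec m)) (hd : ∀ v, nrm v = 0 → v = 0)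
    (y v : Vec m) : y ⬝ᵥ v ≤ dualNorm nrm y * nrm v := by
  obtain ⟨c, hc, hcv⟩ := exists_norm_le_seminorm nrm hd
  have hb : BddAbove ((fun v => y ⬝ᵥ v) '' {v | nrm v ≤ 1}) := by
    refine ⟨(∑ j, |y j|) * c, ?_⟩
    rintro _ ⟨v, hv, rfl⟩
    refine (le_abs_self _).trans ((abs_dotProduct_le y v).trans ?_)
    have : ‖v‖ ≤ c := (hcv v).trans (mul_le_of_le_one_right hc.le hv)
    gcongr
  by_cases hv : v = 0
  · simp [hv]
  have hpos : 0 < nrm v := lt_of_le_of_ne (apply_nonneg nrm v) fun h => hv (hd v h.symm)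
  have h1 : y ⬝ᵥ ((nrm v)⁻¹ • v) ≤ dualNorm nrm y := by
    refine le_csSup hb ⟨_, ?_, rfl⟩
    simp [map_smul_eq_mul, abs_of_pos hpos, hpos.ne']
  rw [dotProduct_smul, smul_eq_mul, inv_mul_le_iff₀ hpos] at h1
  linarith

end Norms

/-! ### Conjugates and subgradients -/

section Conjugate

variable {m : ℕ} {f : Vec m → ℝ}

lemma le_conj {y : Vec m} (hy : y ∈ conjDom f) (v : Vec m) : y ⬝ᵥ v - f v ≤ conj f y :=
  le_ciSup (f := fun v => y ⬝ᵥ v - f v) hy v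

lemma mem_conjDom_iff {y : Vec m} : y ∈ conjDom f ↔ ∃ C : ℝ, ∀ v, y ⬝ᵥ v - f v ≤ C := by
  simp [conjDom, BddAbove, Set.Nonempty, upperBounds]

lemma convex_conjDom : Convex ℝ (conjDom f) := by
  intro y hy z hz a b ha hb hab
  rw [mem_conjDom_iff] at *
  obtain ⟨C, hC⟩ := hy
  obtain ⟨E, hE⟩ := hz
  refine ⟨a * C + b * E, fun v => ?_⟩
  have h1 := mul_le_mul_of_nonneg_left (hC v) ha
  have h2 := mul_le_mul_of_nonneg_left (hE v) hb
  rw [add_dotProduct, smul_dotProduct, smul_dotProduct, smul_eq_mul, smul_eq_mul]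
  have h3 : f v = a * f v + b * f v := by rw [← add_mul, hab, one_mul]
  linarith

/-- The domain is a countable union of closed sublevel sets of the conjugate. -/
lemma measurableSet_conjDom : MeasurableSet (conjDom f) := by
  have : conjDom f = ⋃ n : ℕ, {y | ∀ v, y ⬝ᵥ v - f v ≤ n} := by
    ext y
    rw [mem_conjDom_iff, Set.mem_iUnion]
    constructor
    · rintro ⟨C, hC⟩
      obtain ⟨n, hn⟩ := exists_nat_ge C
      exact ⟨n, fun v => (hC v).trans hn⟩
    · rintro ⟨n, hn⟩
      exact ⟨n, hn⟩
  rw [this]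
  refine MeasurableSet.iUnion fun n => IsClosed.measurableSet ?_
  simp only [Set.ofPred_forall]
  refine isClosed_iInter fun v => isClosed_le ?_ continuous_const
  unfold dotProduct
  fun_prop

/-- If `yᵀv` exceeded `L ‖v‖` for some `v`, the conjugate at `y` would be infinite along the ray
through `v`. Testing with `±e_j` then bounds the coordinates. -/
lemma exists_bound_conjDom (nrm : Seminorm ℝ (Vec m)) (L : ℝ)
    (hL : ∀ v v', |f v - f v'| ≤ L * nrm (v - v')) :
    ∃ B : ℝ, 0 ≤ B ∧ ∀ y ∈ conjDom f, ∀ j, |y j| ≤ B := by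
  have key : ∀ y ∈ conjDom f, ∀ v, y ⬝ᵥ v ≤ L * nrm v := by
    intro y hy v
    obtain ⟨C, hC⟩ := mem_conjDom_iff.1 hy
    by_contra! hlt
    have h0 : 0 ≤ C + f 0 := by have := hC 0; simp at this; linarith
    obtain ⟨n, hn⟩ := exists_nat_gt ((C + f 0) / (y ⬝ᵥ v - L * nrm v))
    rw [div_lt_iff₀ (by linarith)] at hn
    have h1 := hC ((n : ℝ) • v)
    have h2 := (le_abs_self _).trans (hL ((n : ℝ) • v) 0)
    rw [sub_zero, map_smul_eq_mul, Real.norm_eq_abs, abs_of_nonneg (Nat.cast_nonneg n)] at h2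
    rw [dotProduct_smul, smul_eq_mul] at h1
    nlinarith
  refine ⟨∑ j, |L * nrm (Pi.single j 1)|, Finset.sum_nonneg fun _ _ => abs_nonneg _,
    fun y hy j => ?_⟩
  have h1 := key y hy (Pi.single j 1)
  have h2 := key y hy (-Pi.single j 1)
  rw [map_neg_eq_map, dotProduct_neg] at h2
  rw [dotProduct_single, mul_one] at h1 h2
  refine le_trans ?_ (Finset.single_le_sum (f := fun j => |L * nrm (Pi.single j 1)|)
    (fun _ _ => abs_nonneg _) (Finset.mem_univ j))
  refine le_trans ?_ (le_abs_self _)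
  rw [abs_le]
  constructor <;> linarith

lemma continuous_of_seminorm_lipschitz (nrm : Seminorm ℝ (Vec m)) (L : ℝ)
    (hL : ∀ v v', |f v - f v'| ≤ L * nrm (v - v')) : Continuous f := by
  rw [continuous_iff_continuousAt]
  intro v
  rw [ContinuousAt, tendsto_iff_dist_tendsto_zero]
  refine squeeze_zero (fun _ => dist_nonneg) (fun w => hL w v) ?_
  have : Continuous fun w => L * nrm (w - v) :=
    continuous_const.mul ((seminorm_continuous nrm).comp (continuous_id.sub continuous_const))
  simpa using this.tendsto v

/-- A continuous convex function on `ℝᵐ` has a subgradient at every point. -/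
lemma exists_subgradient (hf : ConvexOn ℝ Set.univ f) (hc : Continuous f) (v : Vec m) :
    ∃ y : Vec m, ∀ w, f v + y ⬝ᵥ (w - v) ≤ f w := by
  have ho : IsOpen {p : Vec m × ℝ | p.1 ∈ Set.univ ∧ f p.1 < p.2} := by
    simpa using isOpen_lt (hc.comp continuous_fst) continuous_snd
  -- Separate the open strict epigraph from the graph point above `v`. The functional is negative in
  -- the vertical direction, and dividing by that slope gives the subgradient.
  obtain ⟨F, hF⟩ := geometric_hahn_banach_open_point hf.convex_strict_epigraph ho
    (x := (v, f v)) (by simp)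
  have hsplit : ∀ (w : Vec m) (s : ℝ), F (w, s) = F (w, 0) + s * F (0, 1) := by
    intro w s
    have : ((w, s) : Vec m × ℝ) = (w, 0) + s • (0, 1) := by simp
    rw [this, map_add, map_smul, smul_eq_mul]
  have hneg : F (0, 1) < 0 := by
    have := hF (v, f v + 1) ⟨Set.mem_univ _, by simp⟩
    rw [hsplit, hsplit v (f v)] at this
    linarith
  have hle : ∀ w, F (w, f w) ≤ F (v, f v) := by
    intro w
    refine le_of_forall_pos_le_add fun ε hε => ?_
    have := hF (w, f w + ε / (-F (0, 1))) ⟨Set.mem_univ _, by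
      simp only [lt_add_iff_pos_right]; exact div_pos hε (by linarith)⟩
    rw [hsplit] at this
    rw [hsplit]
    have h2 : ε / (-F (0, 1)) * F (0, 1) = -ε := by
      have := hneg.ne
      field_simp
    rw [add_mul, h2] at this
    linarith
  have hlin : ∀ w : Vec m, F (w, 0) = ∑ j, w j * F (Pi.single j 1, 0) := by
    intro w
    have h1 : ((w, 0) : Vec m × ℝ) = ∑ j, w j • ((Pi.single j 1, 0) : Vec m × ℝ) := by
      ext i
      · rw [Prod.fst_sum, Finset.sum_apply]
        simp [Pi.single_apply]
      · rw [Prod.snd_sum]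
        simp
    rw [h1, map_sum]
    exact Finset.sum_congr rfl fun j _ => by rw [map_smul, smul_eq_mul]
  refine ⟨fun j => (-F (0, 1))⁻¹ * F (Pi.single j 1, 0), fun w => ?_⟩
  have h1 := hle w
  rw [hsplit, hsplit v (f v)] at h1
  have h2 : (fun j => (-F (0, 1))⁻¹ * F (Pi.single j 1, 0)) ⬝ᵥ (w - v)
      = (-F (0, 1))⁻¹ * (F (w, 0) - F (v, 0)) := by
    rw [hlin, hlin, ← Finset.sum_sub_distrib, Finset.mul_sum]
    refine Finset.sum_congr rfl fun j _ => ?_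
    simp only [Pi.sub_apply]
    ring
  rw [h2, ← le_sub_iff_add_le', inv_mul_le_iff₀ (by linarith)]
  linarith

/-- A subgradient at `v` attains equality in the Fenchel–Young inequality. It serves as the
comparator in the regret bound. -/
lemma exists_conj_le (hf : ConvexOn ℝ Set.univ f) (hc : Continuous f) (v : Vec m) :
    ∃ y ∈ conjDom f, conj f y ≤ y ⬝ᵥ v - f v := by
  obtain ⟨y, hy⟩ := exists_subgradient hf hc v
  have h : ∀ w, y ⬝ᵥ w - f w ≤ y ⬝ᵥ v - f v := fun w => by
    have := hy w
    rw [dotProduct_sub] at this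
    linarith
  exact ⟨y, mem_conjDom_iff.2 ⟨_, h⟩, ciSup_le h⟩

end Conjugate

/-! ### Mirror descent -/

section MirrorDescent

variable {m : ℕ} {nrm : Seminorm ℝ (Vec m)} {D : Set (Vec m)} {h : Vec m → ℝ}
  {dh : Vec m → Vec m}

/-- The functional `v ↦ yᵀ v`. -/
def dotCLM (y : Vec m) : Vec m →L[ℝ] ℝ :=
  ∑ j, y j • ContinuousLinearMap.proj (R := ℝ) (φ := fun _ : Fin m => ℝ) j

lemma dotCLM_apply (y v : Vec m) : dotCLM y v = y ⬝ᵥ v := by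
  simp [dotCLM, dotProduct]

lemma IsMirrorMap.bregman_nonneg (hm : IsMirrorMap nrm D h dh) {y z : Vec m} (hy : y ∈ D)
    (hz : z ∈ D) : 1 / 2 * dualNorm nrm (y - z) ^ 2 ≤ bregman h dh y z := by
  have := hm.stronglyConvex y hy z hz
  unfold bregman
  linarith

/-- First-order optimality of the minimizer `y'` in the direction `z - y'`, which is tangent to `D`
at `y'` by convexity. -/
lemma IsMirrorStep.optimality (hm : IsMirrorMap nrm D h dh) (hD : Convex ℝ D) {η : ℝ}
    {q y y' z : Vec m} (hs : IsMirrorStep D h dh η q y y') (hz : z ∈ D) :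
    0 ≤ η * (q ⬝ᵥ (z - y')) + dh y' ⬝ᵥ (z - y') - dh y ⬝ᵥ (z - y') := by
  obtain ⟨f', hf', hd⟩ := hm.hasGradient y' hs.1
  have h1 : HasFDerivWithinAt (fun y'' => η * (q ⬝ᵥ y'') + bregman h dh y'' y)
      (η • dotCLM q + (f' - dotCLM (dh y))) D y' := by
    have e : (fun y'' => η * (q ⬝ᵥ y'') + bregman h dh y'' y)
        = fun y'' => η • dotCLM q y'' + (h y'' - h y - dotCLM (dh y) (y'' - y)) := by
      ext y''
      simp [dotCLM_apply, bregman]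
    rw [e]
    exact ((dotCLM q).hasFDerivWithinAt.const_smul η).add ((hd.sub_const _).sub
      ((dotCLM (dh y)).hasFDerivAt.comp_hasFDerivWithinAt (f := fun y'' => y'' - y) y'
        ((hasFDerivWithinAt_id y' D).sub_const y)))
  have h2 := IsLocalMinOn.hasFDerivWithinAt_nonneg (y := z - y') hs.2.localize h1
    (sub_mem_posTangentConeAt_of_segment_subset (hD.segment_subset hs.1 hz))
  simp only [add_apply, sub_apply,
    smul_apply, dotCLM_apply, hf', smul_eq_mul] at h2
  linarith

/-- Optimality and the three-point identity for Bregman distances leave the terms `η qᵀ(y - y')` and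
`-B(y', y)`; Young's inequality and strong convexity bound their sum by `η² G² / 2`. -/
lemma IsMirrorStep.regret (hd : ∀ v, nrm v = 0 → v = 0) (hm : IsMirrorMap nrm D h dh)
    (hD : Convex ℝ D) {η G : ℝ} (hη : 0 ≤ η) {q y y' z : Vec m} (hq : nrm q ≤ G) (hy : y ∈ D)
    (hs : IsMirrorStep D h dh η q y y') (hz : z ∈ D) :
    η * (q ⬝ᵥ (y - z)) ≤ bregman h dh z y - bregman h dh z y' + η ^ 2 * G ^ 2 / 2 := by
  have h1 := hs.optimality hm hD hz
  have h2 := hm.bregman_nonneg hs.1 hy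
  have h3 : η * (q ⬝ᵥ (y - y')) ≤ η ^ 2 * G ^ 2 / 2 + 1 / 2 * dualNorm nrm (y' - y) ^ 2 := by
    have h4 := dotProduct_le_dualNorm nrm hd (y' - y) (-q)
    rw [map_neg_eq_map] at h4
    have h5 : (y' - y) ⬝ᵥ (-q) = q ⬝ᵥ (y - y') := by
      rw [dotProduct_neg, ← neg_dotProduct, neg_sub, dotProduct_comm]
    rw [h5] at h4
    have h6 : η * (q ⬝ᵥ (y - y')) ≤ η * (dualNorm nrm (y' - y) * nrm q) := by gcongr
    have h7 : (η * nrm q) ^ 2 ≤ (η * G) ^ 2 := by gcongr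
    nlinarith [sq_nonneg (η * nrm q - dualNorm nrm (y' - y))]
  unfold bregman at *
  simp only [dotProduct_sub] at *
  linarith

lemma mirror_regret (hd : ∀ v, nrm v = 0 → v = 0) (hm : IsMirrorMap nrm D h dh)
    (hD : Convex ℝ D) {B G : ℝ} (hB : 0 < B) (hG : 0 < G)
    (hBreg : ∀ y₁ ∈ D, ∀ y₂ ∈ D, bregman h dh y₁ y₂ ≤ B) {T : ℕ} (hT : 1 ≤ T)
    {y : ℕ → Vec m} {q : Fin T → Vec m} (h0 : y 0 ∈ D) (hq : ∀ t, nrm (q t) ≤ G)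
    (hs : ∀ t : Fin T, IsMirrorStep D h dh (√B / (G * √(T : ℝ))) (q t) (y t) (y (t + 1)))
    {z : Vec m} (hz : z ∈ D) :
    ∑ t, q t ⬝ᵥ (y t - z) ≤ 3 / 2 * G * √B * √(T : ℝ) := by
  have hT0 : (0 : ℝ) < T := by exact_mod_cast hT
  set η := √B / (G * √(T : ℝ)) with hηdef
  have hη : 0 < η := by positivity
  have hmem : ∀ n ≤ T, y n ∈ D := by
    intro n hn
    cases n with
    | zero => exact h0
    | succ k => exact (hs ⟨k, hn⟩).1
  have key : ∑ t : Fin T, η * (q t ⬝ᵥ (y t - z))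
      ≤ ∑ t : Fin T, ((bregman h dh z (y t) - bregman h dh z (y (t + 1))) + η ^ 2 * G ^ 2 / 2) :=
    Finset.sum_le_sum fun t _ =>
      (hs t).regret hd hm hD hη.le (hq t) (hmem t t.2.le) hz
  rw [Finset.sum_add_distrib, Finset.sum_const, Finset.card_univ, Fintype.card_fin, nsmul_eq_mul,
    Fin.sum_univ_eq_sum_range (fun t => bregman h dh z (y t) - bregman h dh z (y (t + 1))),
    Finset.sum_range_sub', ← Finset.mul_sum] at key
  have h1 := hBreg z hz (y 0) h0
  have h2 : 0 ≤ bregman h dh z (y T) :=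
    le_trans (by positivity) (hm.bregman_nonneg hz (hmem T le_rfl))
  -- With this step size `η² G² T = B`, so both sides equal `3 B / 2`.
  have h3 : η * (3 / 2 * G * √B * √(T : ℝ)) = B + T * (η ^ 2 * G ^ 2 / 2) := by
    have e1 : √B ^ 2 = B := Real.sq_sqrt hB.le
    have e2 : √(T : ℝ) ^ 2 = T := Real.sq_sqrt hT0.le
    have e3 : √(T : ℝ) ≠ 0 := by positivity
    rw [hηdef]
    conv_rhs => rw [← e1, ← e2]
    rw [Real.sqrt_sq (Real.sqrt_nonneg _), Real.sqrt_sq (Real.sqrt_nonneg _)]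
    field_simp
    ring
  have h4 : η * ∑ t, q t ⬝ᵥ (y t - z) ≤ η * (3 / 2 * G * √B * √(T : ℝ)) := by linarith
  exact le_of_mul_le_mul_left h4 hη

/-- Mirror descent on the conjugate of `f` along the losses `y ↦ -v_tᵀ y + f^*(y)`, compared with
the value of `f` at the average of the `v_t`. -/
lemma mirror_regret_conj {f : Vec m → ℝ} (hf : ConvexOn ℝ Set.univ f) (hc : Continuous f)
    (hd : ∀ v, nrm v = 0 → v = 0) (hm : IsMirrorMap nrm (conjDom f) h dh) {B G : ℝ} (hB : 0 < B)
    (hG : 0 < G) (hBreg : ∀ y₁ ∈ conjDom f, ∀ y₂ ∈ conjDom f, bregman h dh y₁ y₂ ≤ B)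
    {T : ℕ} (hT : 1 ≤ T) {y : ℕ → Vec m} {v : Fin T → Vec m} (h0 : y 0 ∈ conjDom f)
    (hs : ∀ t : Fin T, ∃ q,
      IsSubgradientOn (conjDom f) (fun y => -(v t ⬝ᵥ y) + conj f y) (y t) q ∧ nrm q ≤ G ∧
      IsMirrorStep (conjDom f) h dh (√B / (G * √(T : ℝ))) q (y t) (y (t + 1)))
    (a : Vec m) :
    ∑ t : Fin T, y t ⬝ᵥ (a - v t) - T * f a
      ≤ -(T * f ((1 / (T : ℝ)) • ∑ t, v t)) + 3 / 2 * G * √B * √(T : ℝ) := by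
  choose q hq hqG hstep using hs
  have hT0 : (0 : ℝ) < T := by exact_mod_cast hT
  -- The comparator is chosen in hindsight, which is allowed because the regret bound is pathwise
  -- and holds for every `z`.
  obtain ⟨z, hz, hzc⟩ := exists_conj_le hf hc ((1 / (T : ℝ)) • ∑ t, v t)
  have h1 := mirror_regret hd hm convex_conjDom hB hG hBreg hT h0 hqG hstep hz
  have hmem : ∀ n ≤ T, y n ∈ conjDom f := by
    intro n hn
    cases n with
    | zero => exact h0
    | succ k => exact (hstep ⟨k, hn⟩).1
  -- Fenchel–Young at `a` replaces `y_tᵀ a - f a` by `f^*(y_t)`; the subgradient inequality then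
  -- passes from `y_t` to `z`.
  have h2 : ∑ t : Fin T, (y t ⬝ᵥ (a - v t) - f a)
      ≤ ∑ t : Fin T, (q t ⬝ᵥ (y t - z) + (-(v t ⬝ᵥ z) + conj f z)) := by
    refine Finset.sum_le_sum fun t _ => ?_
    have e1 := hq t z hz
    have e2 := le_conj (hmem t t.2.le) a
    rw [← neg_sub, dotProduct_neg] at e1
    rw [dotProduct_sub, dotProduct_comm _ (v t)]
    linarith
  rw [Finset.sum_add_distrib, Finset.sum_add_distrib, Finset.sum_sub_distrib, Finset.sum_const,
    Finset.sum_const, Finset.card_univ, Fintype.card_fin, nsmul_eq_mul, nsmul_eq_mul] at h2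
  have h3 : ∑ t, -(v t ⬝ᵥ z) = -(T * (z ⬝ᵥ ((1 / (T : ℝ)) • ∑ t, v t))) := by
    rw [Finset.sum_neg_distrib, ← sum_dotProduct, dotProduct_smul, smul_eq_mul,
      dotProduct_comm z]
    field_simp
  have h4 := mul_le_mul_of_nonneg_left hzc hT0.le
  rw [h3] at h2
  linarith

end MirrorDescent

/-! ### The distance function -/

section Distance

variable {m : ℕ} (nrm : Seminorm ℝ (Vec m)) {A : Set (Vec m)}

lemma distTo_bddBelow (v : Vec m) : BddBelow ((fun a => nrm (a - v)) '' A) :=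
  ⟨0, by rintro _ ⟨a, -, rfl⟩; exact apply_nonneg nrm _⟩

lemma distTo_nonneg (v : Vec m) : 0 ≤ distTo nrm A v :=
  Real.sInf_nonneg (by rintro _ ⟨a, -, rfl⟩; exact apply_nonneg nrm _)

lemma distTo_le {a : Vec m} (ha : a ∈ A) (v : Vec m) : distTo nrm A v ≤ nrm (a - v) :=
  csInf_le (distTo_bddBelow nrm v) ⟨a, ha, rfl⟩

lemma distTo_eq_zero {v : Vec m} (hv : v ∈ A) : distTo nrm A v = 0 :=
  le_antisymm (by simpa using distTo_le nrm hv v) (distTo_nonneg nrm v)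

lemma exists_lt_distTo_add (hA : A.Nonempty) (v : Vec m) {ε : ℝ} (hε : 0 < ε) :
    ∃ a ∈ A, nrm (a - v) < distTo nrm A v + ε := by
  obtain ⟨_, ⟨a, ha, rfl⟩, h⟩ := Real.lt_sInf_add_pos (hA.image fun a => nrm (a - v)) hε
  exact ⟨a, ha, h⟩

lemma distTo_lipschitz (hA : A.Nonempty) (v v' : Vec m) :
    |distTo nrm A v - distTo nrm A v'| ≤ 1 * nrm (v - v') := by
  have key : ∀ v v', distTo nrm A v ≤ distTo nrm A v' + nrm (v - v') := by
    intro v v'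
    refine le_of_forall_pos_le_add fun ε hε => ?_
    obtain ⟨a, ha, h⟩ := exists_lt_distTo_add nrm hA v' hε
    have h1 := distTo_le nrm ha v
    have h2 : nrm (a - v) ≤ nrm (a - v') + nrm (v' - v) := by
      have := map_add_le_add nrm (a - v') (v' - v)
      simpa using this
    rw [map_sub_rev nrm v v']
    linarith
  rw [one_mul, abs_le]
  have h1 := key v v'
  have h2 := key v' v
  rw [map_sub_rev nrm v' v] at h2
  constructor <;> linarith

lemma distTo_convexOn (hA : A.Nonempty) (hc : Convex ℝ A) :
    ConvexOn ℝ Set.univ (distTo nrm A) := by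
  refine ⟨convex_univ, fun v _ w _ s t hs ht hst => ?_⟩
  refine le_of_forall_pos_le_add fun ε hε => ?_
  obtain ⟨a, ha, h1⟩ := exists_lt_distTo_add nrm hA v hε
  obtain ⟨b, hb, h2⟩ := exists_lt_distTo_add nrm hA w hε
  have h3 := distTo_le nrm (hc ha hb hs ht hst) (s • v + t • w)
  have h4 : s • a + t • b - (s • v + t • w) = s • (a - v) + t • (b - w) := by module
  rw [h4] at h3
  have h5 := map_add_le_add nrm (s • (a - v)) (t • (b - w))
  rw [map_smul_eq_mul, map_smul_eq_mul, Real.norm_of_nonneg hs, Real.norm_of_nonneg ht] at h5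
  have h6 := mul_le_mul_of_nonneg_left h1.le hs
  have h7 := mul_le_mul_of_nonneg_left h2.le ht
  simp only [smul_eq_mul]
  have h8 : s * ε + t * ε = ε := by rw [← add_mul, hst, one_mul]
  linarith

end Distance

/-! ### Independent samples -/

section Samples

variable {Z : Type} [MeasurableSpace Z] (P : Measure Z) [IsProbabilityMeasure P]

lemma measurePreserving_comp_injective {ι ι' : Type} [Fintype ι] [Fintype ι'] {e : ι' → ι}
    (he : Function.Injective e) :
    MeasurePreserving (fun (z : ι → Z) i => z (e i)) (Measure.pi fun _ => P)
      (Measure.pi fun _ => P) := by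
  refine ⟨by fun_prop, ?_⟩
  have h1 : iIndepFun (fun i (z : ι → Z) => z i) (Measure.pi fun _ => P) :=
    iIndepFun_pi (X := fun _ z => z) fun _ => aemeasurable_id
  have h2 := (h1.precomp he)
  rw [iIndepFun_iff_map_fun_eq_pi_map fun i => (measurable_pi_apply (e i)).aemeasurable] at h2
  rw [h2]
  congr 1
  ext1 i
  exact (measurePreserving_eval (fun _ : ι => P) (e i)).map_eq

lemma measurePreserving_past {t T : ℕ} (h : t ≤ T) :
    MeasurePreserving (past (Z := Z) h) (Measure.pi fun _ => P) (Measure.pi fun _ => P) :=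
  measurePreserving_comp_injective P (Fin.castLE_injective h)

/-- Independence of the current observation from the past: the first `t + 1` coordinates are kept
and the last of them is split off. -/
lemma measurePreserving_past_eval {T : ℕ} (t : Fin T) :
    MeasurePreserving (fun z : Fin T → Z => (past t.2.le z, z t)) (Measure.pi fun _ => P)
      ((Measure.pi fun _ => P).prod P) := by
  have h1 := measurePreserving_past P (Nat.succ_le_of_lt t.2)
  have h2 := measurePreserving_piFinSuccAbove (fun _ : Fin ((t : ℕ) + 1) => P) (Fin.last t)
  have h3 := (Measure.measurePreserving_swap.comp h2).comp h1
  convert h3 using 1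
  ext z i
  · simp [past, MeasurableEquiv.piFinSuccAbove, Fin.init]
  · simp [past, MeasurableEquiv.piFinSuccAbove]
    rfl

end Samples

/-! ### Integrals of sums of three functions -/

section Sums

variable {α : Type*} [MeasurableSpace α] {ν : Measure α} {f g h : α → ℝ}

lemma integral_add_add (hf : Integrable f ν) (hg : Integrable g ν) (hh : Integrable h ν) :
    ∫ a, (f a + g a + h a) ∂ν = ∫ a, f a ∂ν + ∫ a, g a ∂ν + ∫ a, h a ∂ν := by
  have hfg : Integrable (fun a => f a + g a) ν := hf.add hg
  rw [integral_add hfg hh, integral_add hf hg]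

lemma integral_sub_sub (hf : Integrable f ν) (hg : Integrable g ν) (hh : Integrable h ν) :
    ∫ a, (f a - g a - h a) ∂ν = ∫ a, f a ∂ν - ∫ a, g a ∂ν - ∫ a, h a ∂ν := by
  have hfg : Integrable (fun a => f a - g a) ν := hf.sub hg
  rw [integral_sub hfg hh, integral_sub hf hg]

end Sums

/-! ### Linear costs -/

section Costs

variable {d m : ℕ}

lemma consume_apply (V : Fin d → Fin m → ℝ) (w : Vec d) (j : Fin m) :
    consume V w j = ∑ i, V i j * w i := rfl

lemma cost_dotProduct (ζ : ℝ) (μ : Coeff d m) (ω : Vec m × Vec m) (w : Vec d) :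
    cost ζ μ ω ⬝ᵥ w
      = μ.1 ⬝ᵥ w - ω.1 ⬝ᵥ consume μ.2 w - ζ * (ω.2 ⬝ᵥ consume μ.2 w) := by
  have h : ∀ l : Vec m, (Matrix.of μ.2 *ᵥ l) ⬝ᵥ w = l ⬝ᵥ consume μ.2 w := by
    intro l
    rw [consume, Matrix.mulVec_transpose, dotProduct_comm, Matrix.dotProduct_mulVec,
      dotProduct_comm]
  rw [cost, sub_dotProduct, sub_dotProduct, smul_dotProduct, h, h, smul_eq_mul]

lemma measurable_dotProduct {α : Type*} [MeasurableSpace α] {n : ℕ} {f g : α → Vec n}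
    (hf : Measurable f) (hg : Measurable g) : Measurable fun a => f a ⬝ᵥ g a := by
  unfold dotProduct
  fun_prop

lemma measurable_consume {α : Type*} [MeasurableSpace α] {f : α → Fin d → Fin m → ℝ}
    {g : α → Vec d} (hf : Measurable f) (hg : Measurable g) :
    Measurable fun a => consume (f a) (g a) := by
  refine measurable_pi_lambda _ fun j => ?_
  simp only [consume_apply]
  fun_prop

lemma measurable_cost_dotProduct {α : Type*} [MeasurableSpace α] {ζ : ℝ} {f : α → Coeff d m}
    {ω : α → Vec m × Vec m} {g : α → Vec d} (hf : Measurable f) (hω : Measurable ω)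
    (hg : Measurable g) : Measurable fun a => cost ζ (f a) (ω a) ⬝ᵥ g a := by
  simp only [cost_dotProduct]
  have h := measurable_consume hf.snd hg
  exact ((measurable_dotProduct hf.fst hg).sub (measurable_dotProduct hω.fst h)).sub
    ((measurable_dotProduct hω.snd h).const_mul ζ)

end Costs

/-! ### Basic facts on the decision problem -/

namespace Problem

variable {p d m : ℕ} (Q : Problem p d m)

lemma exists_bound_S : ∃ R : ℝ, 0 ≤ R ∧ ∀ w ∈ Q.S, ∀ i, |w i| ≤ R := by
  obtain ⟨R, hR⟩ := Q.S_compact.isBounded.exists_norm_le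
  refine ⟨max R 0, le_max_right _ _, fun w hw i => ?_⟩
  exact (norm_le_pi_norm w i).trans ((hR w hw).trans (le_max_left _ _))

/-- An integrable bound on rewards and consumptions. -/
lemma exists_envelope : ∃ E : Coeff d m → ℝ, Integrable (fun z : Obs p d m => E z.2) Q.P ∧
    ∀ μ, 0 ≤ E μ ∧ ∀ w ∈ Q.S, |μ.1 ⬝ᵥ w| ≤ E μ ∧ ∀ j, |consume μ.2 w j| ≤ E μ := by
  obtain ⟨R, hR0, hR⟩ := Q.exists_bound_S
  refine ⟨fun μ => R * ∑ i, (|μ.1 i| + ∑ j, |μ.2 i j|), ?_, fun μ => ⟨by positivity, ?_⟩⟩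
  · refine Integrable.const_mul (integrable_finsetSum _ fun i _ => ?_) R
    exact (Q.r_integrable i).abs.add (integrable_finsetSum _ fun j _ => (Q.V_integrable i j).abs)
  intro w hw
  simp only [Finset.mul_sum]
  refine ⟨?_, fun j => ?_⟩
  · refine (Finset.abs_sum_le_sum_abs _ _).trans (Finset.sum_le_sum fun i _ => ?_)
    rw [abs_mul, mul_comm]
    refine mul_le_mul (hR w hw i) ?_ (abs_nonneg _) hR0
    exact le_add_of_nonneg_right (Finset.sum_nonneg fun _ _ => abs_nonneg _)
  · rw [consume_apply]
    refine (Finset.abs_sum_le_sum_abs _ _).trans (Finset.sum_le_sum fun i _ => ?_)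
    rw [abs_mul, mul_comm]
    refine mul_le_mul (hR w hw i) ?_ (abs_nonneg _) hR0
    exact (Finset.single_le_sum (f := fun j => |μ.2 i j|) (fun _ _ => abs_nonneg _)
      (Finset.mem_univ j)).trans (le_add_of_nonneg_left (abs_nonneg _))

lemma dist_convexOn : ConvexOn ℝ Set.univ Q.dist :=
  distTo_convexOn Q.nrm Q.feas_nonempty Q.feas_convex

lemma dist_lipschitz (v v' : Vec m) : |Q.dist v - Q.dist v'| ≤ 1 * Q.nrm (v - v') :=
  distTo_lipschitz Q.nrm Q.feas_nonempty v v'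

lemma dist_continuous : Continuous Q.dist :=
  continuous_of_seminorm_lipschitz Q.nrm 1 Q.dist_lipschitz

lemma dist_nonneg (v : Vec m) : 0 ≤ Q.dist v := distTo_nonneg Q.nrm v

lemma neg_u_lipschitz (v v' : Vec m) : |-Q.u v - -Q.u v'| ≤ Q.L * Q.nrm (v - v') := by
  rw [← abs_neg]
  convert Q.u_lipschitz v v' using 2
  ring

lemma u_continuous : Continuous Q.u :=
  continuous_of_seminorm_lipschitz Q.nrm Q.L Q.u_lipschitz

lemma measurableSet_dual : MeasurableSet (Q.Lam ×ˢ Q.Tht) :=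
  measurableSet_conjDom.prod measurableSet_conjDom

lemma exists_bound_dual :
    ∃ B : ℝ, 0 ≤ B ∧ ∀ ω ∈ Q.Lam ×ˢ Q.Tht, ∀ j, |ω.1 j| ≤ B ∧ |ω.2 j| ≤ B := by
  obtain ⟨B₁, h1, hB₁⟩ := exists_bound_conjDom Q.nrm Q.L Q.neg_u_lipschitz
  obtain ⟨B₂, h2, hB₂⟩ := exists_bound_conjDom Q.nrm 1 Q.dist_lipschitz
  exact ⟨max B₁ B₂, le_max_of_le_left h1, fun ω hω j =>
    ⟨(hB₁ _ hω.1 j).trans (le_max_left _ _), (hB₂ _ hω.2 j).trans (le_max_right _ _)⟩⟩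

/-- An integrable bound on the linear costs of feasible decisions. -/
lemma exists_cost_envelope (ζ : ℝ) :
    ∃ E : Coeff d m → ℝ, Integrable (fun z : Obs p d m => E z.2) Q.P ∧
      ∀ μ, ∀ ω ∈ Q.Lam ×ˢ Q.Tht, ∀ w ∈ Q.S, |cost ζ μ ω ⬝ᵥ w| ≤ E μ := by
  obtain ⟨E, hE, hb⟩ := Q.exists_envelope
  obtain ⟨B, hB0, hB⟩ := Q.exists_bound_dual
  refine ⟨fun μ => (1 + m * B + |ζ| * (m * B)) * E μ, hE.const_mul _, fun μ ω hω w hw => ?_⟩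
  obtain ⟨h0, h⟩ := hb μ
  have key : ∀ l : Vec m, (∀ j, |l j| ≤ B) → |l ⬝ᵥ consume μ.2 w| ≤ m * B * E μ := by
    intro l hl
    refine (Finset.abs_sum_le_sum_abs _ _).trans
      ((Finset.sum_le_sum (g := fun _ => B * E μ) fun j _ => ?_).trans ?_)
    · rw [abs_mul]
      exact mul_le_mul (hl j) ((h w hw).2 j) (abs_nonneg _) hB0
    · simp [mul_assoc]
  have h1 := key ω.1 fun j => (hB ω hω j).1
  have h2 := key ω.2 fun j => (hB ω hω j).2
  have h3 := (h w hw).1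
  rw [cost_dotProduct]
  have h4 : |ζ * (ω.2 ⬝ᵥ consume μ.2 w)| ≤ |ζ| * (m * B * E μ) := by
    rw [abs_mul]; gcongr
  calc _ ≤ |μ.1 ⬝ᵥ w| + |ω.1 ⬝ᵥ consume μ.2 w| + |ζ * (ω.2 ⬝ᵥ consume μ.2 w)| :=
        (abs_sub _ _).trans (add_le_add_left (abs_sub _ _) _)
    _ ≤ E μ + m * B * E μ + |ζ| * (m * B * E μ) := by linarith
    _ = _ := by ring

section Averages

variable {Ω : Type} [MeasurableSpace Ω] (ν : Measure Ω)

/-- Integrability of linear functionals of a feasible decision depending on the context and on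
independent randomness. -/
lemma integrable_reward [IsProbabilityMeasure ν] {W : Ω × Vec p → Vec d} (hW : Measurable W)
    (hS : ∀ᵐ s ∂ν, ∀ x, W (s, x) ∈ Q.S) :
    Integrable (fun q : Ω × Obs p d m => q.2.2.1 ⬝ᵥ W (q.1, q.2.1)) (ν.prod Q.P) := by
  obtain ⟨E, hE, hb⟩ := Q.exists_envelope
  refine (hE.comp_snd ν).mono' (measurable_dotProduct (by fun_prop)
    (by fun_prop)).aestronglyMeasurable ?_
  filter_upwards [Measure.quasiMeasurePreserving_fst.ae hS] with q hq
  exact ((hb q.2.2).2 _ (hq _)).1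

lemma integrable_consume [IsProbabilityMeasure ν] {W : Ω × Vec p → Vec d} (hW : Measurable W)
    (hS : ∀ᵐ s ∂ν, ∀ x, W (s, x) ∈ Q.S) (j : Fin m) :
    Integrable (fun q : Ω × Obs p d m => consume q.2.2.2 (W (q.1, q.2.1)) j) (ν.prod Q.P) := by
  obtain ⟨E, hE, hb⟩ := Q.exists_envelope
  refine (hE.comp_snd ν).mono' ((measurable_pi_apply j).comp (measurable_consume (by fun_prop)
    (by fun_prop))).aestronglyMeasurable ?_
  filter_upwards [Measure.quasiMeasurePreserving_fst.ae hS] with q hq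
  exact ((hb q.2.2).2 _ (hq _)).2 j

lemma integrable_cost [IsProbabilityMeasure ν] {ζ : ℝ} {W : Ω × Obs p d m → Vec d}
    (hW : Measurable W) (hS : ∀ᵐ s ∂ν, ∀ o, W (s, o) ∈ Q.S) {ω : Ω → Vec m × Vec m}
    (hω : Measurable ω) (hωm : ∀ᵐ s ∂ν, ω s ∈ Q.Lam ×ˢ Q.Tht) :
    Integrable (fun q : Ω × Obs p d m => cost ζ q.2.2 (ω q.1) ⬝ᵥ W q) (ν.prod Q.P) := by
  obtain ⟨E, hE, hb⟩ := Q.exists_cost_envelope ζ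
  refine (hE.comp_snd ν).mono' (measurable_cost_dotProduct (by fun_prop) (by fun_prop)
    hW).aestronglyMeasurable ?_
  filter_upwards [Measure.quasiMeasurePreserving_fst.ae hS,
    Measure.quasiMeasurePreserving_fst.ae hωm] with q hq hq'
  exact hb _ _ hq' _ (hq _)

/-- Averaging a randomized policy over its randomness gives a static policy with the same expected
reward and consumption. -/
lemma exists_policy [IsProbabilityMeasure ν] {W : Ω × Vec p → Vec d} (hW : Measurable W)
    (hS : ∀ᵐ s ∂ν, ∀ x, W (s, x) ∈ Q.S) :
    ∃ π ∈ Q.policies,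
      Q.rew π = ∫ q : Ω × Obs p d m, q.2.2.1 ⬝ᵥ W (q.1, q.2.1) ∂(ν.prod Q.P) ∧
      ∀ j, Q.con π j
        = ∫ q : Ω × Obs p d m, consume q.2.2.2 (W (q.1, q.2.1)) j ∂(ν.prod Q.P) := by
  obtain ⟨R, hR0, hR⟩ := Q.exists_bound_S
  have hint : ∀ x i, Integrable (fun s => W (s, x) i) ν := by
    intro x i
    refine (integrable_const R).mono' (by fun_prop : Measurable _).aestronglyMeasurable ?_
    filter_upwards [hS] with s hs
    exact hR _ (hs x) i
  refine ⟨fun x => ∫ s, W (s, x) ∂ν, ⟨?_, fun x => ?_⟩, ?_, fun j => ?_⟩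
  · exact (StronglyMeasurable.integral_prod_left' (f := W) hW.stronglyMeasurable).measurable
  -- The mean of a random point of a closed convex set stays in the set. Reward and consumption are
  -- linear in the decision, so Fubini finishes.
  · refine Q.S_convex.integral_mem Q.S_compact.isClosed (hS.mono fun s hs => hs x) ?_
    exact Integrable.of_eval fun i => hint x i
  · rw [rew, integral_prod_symm _ (Q.integrable_reward ν hW hS)]
    refine integral_congr_ae (ae_of_all _ fun o => ?_)
    simp only [dotProduct]
    rw [integral_finsetSum _ fun i _ => (hint _ i).const_mul _]
    refine Finset.sum_congr rfl fun i _ => ?_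
    rw [integral_const_mul, eval_integral fun i => hint _ i]
  · rw [con, integral_prod_symm _ (Q.integrable_consume ν hW hS j)]
    refine integral_congr_ae (ae_of_all _ fun o => ?_)
    simp only [consume_apply]
    rw [integral_finsetSum _ fun i _ => (hint _ i).const_mul _]
    refine Finset.sum_congr rfl fun i _ => ?_
    rw [integral_const_mul, eval_integral fun i => hint _ i]

end Averages

lemma integrable_reward_of_mem {φ : Vec p → Vec d} (hφ : φ ∈ Q.policies) :
    Integrable (fun z : Obs p d m => z.2.1 ⬝ᵥ φ z.1) Q.P := by
  obtain ⟨E, hE, hb⟩ := Q.exists_envelope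
  have hm := hφ.1
  refine hE.mono' (measurable_dotProduct (by fun_prop) (by fun_prop)).aestronglyMeasurable ?_
  exact ae_of_all _ fun z => ((hb z.2).2 _ (hφ.2 _)).1

lemma integrable_consume_of_mem {φ : Vec p → Vec d} (hφ : φ ∈ Q.policies) (j : Fin m) :
    Integrable (fun z : Obs p d m => consume z.2.2 (φ z.1) j) Q.P := by
  obtain ⟨E, hE, hb⟩ := Q.exists_envelope
  have hm := hφ.1
  refine hE.mono' ((measurable_pi_apply j).comp (measurable_consume (by fun_prop)
    (by fun_prop))).aestronglyMeasurable ?_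
  exact ae_of_all _ fun z => ((hb z.2).2 _ (hφ.2 _)).2 j

lemma integrable_cost_of_mem (ζ : ℝ) {ω : Vec m × Vec m} (hω : ω ∈ Q.Lam ×ˢ Q.Tht)
    {W : Obs p d m → Vec d} (hW : Measurable W) (hS : ∀ o, W o ∈ Q.S) :
    Integrable (fun z : Obs p d m => cost ζ z.2 ω ⬝ᵥ W z) Q.P := by
  obtain ⟨E, hE, hb⟩ := Q.exists_cost_envelope ζ
  refine hE.mono' (measurable_cost_dotProduct (by fun_prop) (by fun_prop)
    hW).aestronglyMeasurable ?_
  exact ae_of_all _ fun z => hb _ _ hω _ (hS _)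

lemma integral_cost_policy (ζ : ℝ) (ω : Vec m × Vec m) {φ : Vec p → Vec d}
    (hφ : φ ∈ Q.policies) :
    ∫ z, cost ζ z.2 ω ⬝ᵥ φ z.1 ∂Q.P
      = Q.rew φ - ω.1 ⬝ᵥ Q.con φ - ζ * (ω.2 ⬝ᵥ Q.con φ) := by
  have hl : ∀ l : Vec m, Integrable (fun z : Obs p d m => l ⬝ᵥ consume z.2.2 (φ z.1)) Q.P :=
    fun l => integrable_finsetSum _ fun j _ => (Q.integrable_consume_of_mem hφ j).const_mul _
  have hl' : ∀ l : Vec m, ∫ z, l ⬝ᵥ consume z.2.2 (φ z.1) ∂Q.P = l ⬝ᵥ Q.con φ := by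
    intro l
    simp only [dotProduct]
    rw [integral_finsetSum _ fun j _ => (Q.integrable_consume_of_mem hφ j).const_mul _]
    exact Finset.sum_congr rfl fun j _ => integral_const_mul _ _
  simp only [cost_dotProduct]
  rw [integral_sub_sub (Q.integrable_reward_of_mem hφ) (hl _) ((hl _).const_mul _),
    integral_const_mul, hl', hl', rew]

lemma measurable_gstar : Measurable Q.gstar := by
  refine Measurable.prodMk (measurable_pi_lambda _ fun i => ?_)
    (measurable_pi_lambda _ fun i => measurable_pi_lambda _ fun j => ?_)
  · exact (StronglyMeasurable.integral_kernel_prod_right' (κ := Q.P.condKernel)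
      (f := fun z : Vec p × Coeff d m => z.2.1 i)
      (by fun_prop : Measurable _).stronglyMeasurable).measurable
  · exact (StronglyMeasurable.integral_kernel_prod_right' (κ := Q.P.condKernel)
      (f := fun z : Vec p × Coeff d m => z.2.2 i j)
      (by fun_prop : Measurable _).stronglyMeasurable).measurable

/-- Given the context, the expected linear cost is the cost for the ground truth prediction. -/
lemma integral_cost_eq_gstar (ζ : ℝ) {ω : Vec m × Vec m} (hω : ω ∈ Q.Lam ×ˢ Q.Tht)
    {φ : Vec p → Vec d} (hφ : φ ∈ Q.policies) :
    Integrable (fun x => cost ζ (Q.gstar x) ω ⬝ᵥ φ x) Q.P.fst ∧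
    ∫ z, cost ζ z.2 ω ⬝ᵥ φ z.1 ∂Q.P = ∫ x, cost ζ (Q.gstar x) ω ⬝ᵥ φ x ∂Q.P.fst := by
  have hm := hφ.1
  have hint := Q.integrable_cost_of_mem ζ hω (W := fun z => φ z.1) (by fun_prop) fun z => hφ.2 _
  have hr : ∀ᵐ x ∂Q.P.fst, ∀ i,
      Integrable (fun μ : Coeff d m => μ.1 i) (Q.P.condKernel x) :=
    ae_all_iff.2 fun i => (Q.r_integrable i).condKernel_ae
  have hV : ∀ᵐ x ∂Q.P.fst, ∀ i j,
      Integrable (fun μ : Coeff d m => μ.2 i j) (Q.P.condKernel x) :=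
    ae_all_iff.2 fun i => ae_all_iff.2 fun j => (Q.V_integrable i j).condKernel_ae
  have hae : ∀ᵐ x ∂Q.P.fst, ∫ μ, cost ζ μ ω ⬝ᵥ φ x ∂(Q.P.condKernel x)
      = cost ζ (Q.gstar x) ω ⬝ᵥ φ x := by
    filter_upwards [hr, hV] with x hrx hVx
    -- The cost is linear in `μ`, so its conditional mean is the cost at the conditional mean
    -- `g^*(x)`.
    have e : ∀ μ : Coeff d m, cost ζ μ ω ⬝ᵥ φ x
        = ∑ i, (μ.1 i - ∑ j, μ.2 i j * ω.1 j - ζ * ∑ j, μ.2 i j * ω.2 j) * φ x i := by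
      intro μ
      simp [cost, dotProduct, Matrix.mulVec]
    have hs : ∀ (l : Vec m) i, Integrable (fun μ : Coeff d m => ∑ j, μ.2 i j * l j)
        (Q.P.condKernel x) :=
      fun l i => integrable_finsetSum _ fun j _ => (hVx i j).mul_const _
    have hs' : ∀ (l : Vec m) i, ∫ μ : Coeff d m, ∑ j, μ.2 i j * l j ∂(Q.P.condKernel x)
        = ∑ j, (Q.gstar x).2 i j * l j := by
      intro l i
      rw [integral_finsetSum _ fun j _ => (hVx i j).mul_const _]
      exact Finset.sum_congr rfl fun j _ => integral_mul_const _ _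
    simp only [e]
    have hi : ∀ i, Integrable (fun μ : Coeff d m =>
        (μ.1 i - ∑ j, μ.2 i j * ω.1 j - ζ * ∑ j, μ.2 i j * ω.2 j) * φ x i)
        (Q.P.condKernel x) :=
      fun i => (((hrx i).sub (hs _ i)).sub ((hs _ i).const_mul _)).mul_const _
    rw [integral_finsetSum _ fun i _ => hi i]
    refine Finset.sum_congr rfl fun i _ => ?_
    rw [integral_mul_const, integral_sub_sub (hrx i) (hs _ i) ((hs _ i).const_mul _),
      integral_const_mul, hs', hs']
    rfl
  refine ⟨hint.integral_condKernel.congr hae, ?_⟩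
  rw [← Measure.integral_condKernel hint]
  exact integral_congr_ae hae

end Problem

namespace Method

variable {p d m : ℕ} {Q : Problem p d m} (M : Method Q)

lemma oracle_policy {g : Vec p → Coeff d m} (hg : Measurable g) {ω : Vec m × Vec m}
    (hω : ω ∈ Q.Lam ×ˢ Q.Tht) : (fun x => M.oracle (g x) ω) ∈ Q.policies :=
  ⟨M.oracle_measurable.comp (hg.prodMk measurable_const), fun _ => (M.oracle_spec _ ω hω).1⟩

lemma spoRisk_eq {g : Vec p → Coeff d m} (hg : Measurable g) {ω : Vec m × Vec m}
    (hω : ω ∈ Q.Lam ×ˢ Q.Tht) :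
    M.spoRisk g ω = ∫ z, cost M.ζ z.2 ω ⬝ᵥ M.oracle z.2 ω ∂Q.P
      - ∫ z, cost M.ζ z.2 ω ⬝ᵥ M.oracle (g z.1) ω ∂Q.P := by
  have h1 : Measurable fun z : Obs p d m => M.oracle z.2 ω :=
    M.oracle_measurable.comp (measurable_snd.prodMk measurable_const)
  have h2 : Measurable fun z : Obs p d m => M.oracle (g z.1) ω :=
    (M.oracle_policy hg hω).1.comp measurable_fst
  rw [← integral_sub
    (Q.integrable_cost_of_mem M.ζ hω h1 fun z => (M.oracle_spec _ ω hω).1)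
    (Q.integrable_cost_of_mem M.ζ hω h2 fun z => (M.oracle_spec _ ω hω).1)]
  simp only [spoRisk, spoLoss, dotProduct_sub]

/-- The suboptimality of the decisions for the prediction `g`, compared to any policy, is at most
the excess risk of `g`. -/
lemma policy_le_excess_risk {g : Vec p → Coeff d m} (hg : Measurable g) {ω : Vec m × Vec m}
    (hω : ω ∈ Q.Lam ×ˢ Q.Tht) {π : Vec p → Vec d} (hπ : π ∈ Q.policies) :
    Q.rew π - ω.1 ⬝ᵥ Q.con π - M.ζ * (ω.2 ⬝ᵥ Q.con π)
      - ∫ z, cost M.ζ z.2 ω ⬝ᵥ M.oracle (g z.1) ω ∂Q.P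
      ≤ M.spoRisk g ω - M.spoRisk Q.gstar ω := by
  -- The full-information terms of the two risks cancel. What remains is that the oracle at `g^*(x)`
  -- beats `π x` for the conditional mean cost.
  rw [M.spoRisk_eq hg hω, M.spoRisk_eq Q.measurable_gstar hω, ← Q.integral_cost_policy M.ζ ω hπ]
  have h1 := Q.integral_cost_eq_gstar M.ζ hω hπ
  have h2 := Q.integral_cost_eq_gstar M.ζ hω (M.oracle_policy Q.measurable_gstar hω)
  have h3 : ∫ x, cost M.ζ (Q.gstar x) ω ⬝ᵥ π x ∂Q.P.fst
      ≤ ∫ x, cost M.ζ (Q.gstar x) ω ⬝ᵥ M.oracle (Q.gstar x) ω ∂Q.P.fst :=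
    integral_mono h1.1 h2.1 fun _ => (M.oracle_spec _ ω hω).2 (hπ.2 _)
  rw [← h1.2, ← h2.2] at h3
  linarith

/-- The excess risk is bounded, uniformly in the predictor and the dual variables. -/
lemma exists_excess_risk_bound : ∃ B : ℝ, 0 ≤ B ∧ ∀ g : Vec p → Coeff d m, Measurable g →
    ∀ ω ∈ Q.Lam ×ˢ Q.Tht, M.spoRisk g ω - M.spoRisk Q.gstar ω ≤ B := by
  obtain ⟨E, hE, hb⟩ := Q.exists_cost_envelope M.ζ
  refine ⟨max (2 * ∫ z, E z.2 ∂Q.P) 0, le_max_right _ _, fun g hg ω hω => ?_⟩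
  refine le_trans ?_ (le_max_left _ _)
  have key : ∀ g : Vec p → Coeff d m, Measurable g →
      |∫ z, cost M.ζ z.2 ω ⬝ᵥ M.oracle (g z.1) ω ∂Q.P| ≤ ∫ z, E z.2 ∂Q.P := by
    intro g hg
    rw [← Real.norm_eq_abs]
    exact norm_integral_le_of_norm_le hE
      (ae_of_all _ fun z => hb _ _ hω _ (M.oracle_spec _ ω hω).1)
  rw [M.spoRisk_eq hg hω, M.spoRisk_eq Q.measurable_gstar hω]
  have h1 := abs_le.1 (key g hg)
  have h2 := abs_le.1 (key _ Q.measurable_gstar)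
  linarith

/-- The expected linear cost of a round, compared to a policy: `ν` is the law of the past. -/
lemma rew_le_round {Ω : Type} [MeasurableSpace Ω] (ν : Measure Ω) [IsProbabilityMeasure ν]
    {ω : Ω → Vec m × Vec m} (hω : Measurable ω) (hωm : ∀ᵐ s ∂ν, ω s ∈ Q.Lam ×ˢ Q.Tht)
    {g : Ω → Vec p → Coeff d m} (hg : Measurable fun q : Ω × Vec p => g q.1 q.2)
    {e : ℝ} (he : 0 ≤ e)
    (hrisk : ∫⁻ s, ENNReal.ofReal (M.spoRisk (g s) (ω s) - M.spoRisk Q.gstar (ω s)) ∂ν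
      ≤ ENNReal.ofReal e)
    {π : Vec p → Vec d} (hπ : π ∈ Q.policies) :
    Integrable (fun q : Ω × Obs p d m =>
      cost M.ζ q.2.2 (ω q.1) ⬝ᵥ M.oracle (g q.1 q.2.1) (ω q.1)
        + (ω q.1).1 ⬝ᵥ Q.con π + M.ζ * ((ω q.1).2 ⬝ᵥ Q.con π)) (ν.prod Q.P) ∧
    Q.rew π ≤ ∫ q : Ω × Obs p d m,
      (cost M.ζ q.2.2 (ω q.1) ⬝ᵥ M.oracle (g q.1 q.2.1) (ω q.1)
        + (ω q.1).1 ⬝ᵥ Q.con π + M.ζ * ((ω q.1).2 ⬝ᵥ Q.con π)) ∂(ν.prod Q.P) + e := by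
  obtain ⟨B, hB0, hB⟩ := Q.exists_bound_dual
  have hgs : ∀ s, Measurable (g s) := fun s => hg.comp measurable_prodMk_left
  have hW : Measurable fun q : Ω × Obs p d m => M.oracle (g q.1 q.2.1) (ω q.1) :=
    M.oracle_measurable.comp ((hg.comp (measurable_fst.prodMk measurable_snd.fst)).prodMk
      (hω.comp measurable_fst))
  have h1 := Q.integrable_cost ν (ζ := M.ζ) hW
    (hωm.mono fun s hs o => (M.oracle_spec (g s o.1) (ω s) hs).1) hω hωm
  have hlin : Integrable (fun s => (ω s).1 ⬝ᵥ Q.con π) ν ∧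
      Integrable (fun s => (ω s).2 ⬝ᵥ Q.con π) ν := by
    constructor
    · refine integrable_finsetSum _ fun j _ => Integrable.mul_const ?_ _
      refine (integrable_const B).mono' (by fun_prop : Measurable _).aestronglyMeasurable ?_
      exact hωm.mono fun s hs => (hB _ hs j).1
    · refine integrable_finsetSum _ fun j _ => Integrable.mul_const ?_ _
      refine (integrable_const B).mono' (by fun_prop : Measurable _).aestronglyMeasurable ?_
      exact hωm.mono fun s hs => (hB _ hs j).2
  have h2 : Integrable (fun q : Ω × Obs p d m => (ω q.1).1 ⬝ᵥ Q.con π) (ν.prod Q.P) :=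
    hlin.1.comp_fst Q.P
  have h3 : Integrable (fun q : Ω × Obs p d m => M.ζ * ((ω q.1).2 ⬝ᵥ Q.con π)) (ν.prod Q.P) :=
    (hlin.2.const_mul M.ζ).comp_fst Q.P
  refine ⟨(h1.add h2).add h3, ?_⟩
  set H : Ω → ℝ := fun s => (∫ z, cost M.ζ z.2 (ω s) ⬝ᵥ M.oracle (g s z.1) (ω s) ∂Q.P)
    + (ω s).1 ⬝ᵥ Q.con π + M.ζ * ((ω s).2 ⬝ᵥ Q.con π) with hH
  have hHi : Integrable H ν := (h1.integral_prod_left.add hlin.1).add (hlin.2.const_mul M.ζ)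
  have hint : ∫ q : Ω × Obs p d m,
      (cost M.ζ q.2.2 (ω q.1) ⬝ᵥ M.oracle (g q.1 q.2.1) (ω q.1)
        + (ω q.1).1 ⬝ᵥ Q.con π + M.ζ * ((ω q.1).2 ⬝ᵥ Q.con π)) ∂(ν.prod Q.P) = ∫ s, H s ∂ν := by
    rw [integral_add_add h1 h2 h3, integral_prod _ h1, integral_prod _ h2, integral_prod _ h3, hH,
      integral_add_add h1.integral_prod_left hlin.1 (hlin.2.const_mul M.ζ)]
    simp
  rw [hint]
  have hle : ∫⁻ s, ENNReal.ofReal (Q.rew π - H s) ∂ν ≤ ENNReal.ofReal e := by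
    refine le_trans (lintegral_mono_ae ?_) hrisk
    filter_upwards [hωm] with s hs
    refine ENNReal.ofReal_le_ofReal ?_
    have := M.policy_le_excess_risk (hgs s) hs hπ
    simp only [hH]
    linarith
  have h5 : ∫ s, (Q.rew π - H s) ∂ν ≤ e := by
    have hi : Integrable (fun s => Q.rew π - H s) ν := (integrable_const _).sub hHi
    -- The risk bound controls only the positive part, which suffices since the negative part lowers
    -- the integral.
    rw [integral_eq_lintegral_pos_part_sub_lintegral_neg_part hi]
    have h6 := ENNReal.toReal_mono ENNReal.ofReal_ne_top hle
    rw [ENNReal.toReal_ofReal he] at h6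
    have h7 : 0 ≤ (∫⁻ s, ENNReal.ofReal (-(Q.rew π - H s)) ∂ν).toReal := ENNReal.toReal_nonneg
    linarith
  rw [integral_sub (integrable_const _) hHi, integral_const] at h5
  simp at h5
  linarith

end Method

lemma integrable_comp_lipschitz {m : ℕ} {Ω : Type} [MeasurableSpace Ω] {ν : Measure Ω}
    [IsProbabilityMeasure ν] {X : Ω → Vec m} (hX : ∀ j, Integrable (fun s => X s j) ν)
    (nrm : Seminorm ℝ (Vec m)) {f : Vec m → ℝ} {L : ℝ}
    (hf : ∀ v v', |f v - f v'| ≤ L * nrm (v - v')) : Integrable (fun s => f (X s)) ν := by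
  have hXi : Integrable X ν := Integrable.of_eval hX
  have hb : Integrable (fun s => |f 0| + |L| * ∑ j, |X s j| * nrm (Pi.single j 1)) ν :=
    (integrable_const _).add
      ((integrable_finsetSum _ fun j _ => (hX j).abs.mul_const _).const_mul _)
  refine hb.mono' ((continuous_of_seminorm_lipschitz nrm L hf).comp_aestronglyMeasurable
    hXi.aestronglyMeasurable) (ae_of_all _ fun s => ?_)
  have h1 := hf (X s) 0
  rw [sub_zero] at h1
  have h2 : L * nrm (X s) ≤ |L| * ∑ j, |X s j| * nrm (Pi.single j 1) :=
    mul_le_mul (le_abs_self L) (seminorm_le_sum nrm _) (apply_nonneg nrm _) (abs_nonneg L)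
  have h3 : |f (X s)| ≤ |f (X s) - f 0| + |f 0| := by
    simpa using abs_add_le (f (X s) - f 0) (f 0)
  rw [Real.norm_eq_abs]
  linarith

/-- The average of finitely many static policies. -/
lemma Problem.exists_mean_policy {p d m : ℕ} (Q : Problem p d m) {T : ℕ} (hT : 1 ≤ T)
    {π : Fin T → Vec p → Vec d} (hπ : ∀ t, π t ∈ Q.policies) :
    ∃ π' ∈ Q.policies, Q.rew π' = 1 / (T : ℝ) * ∑ t, Q.rew (π t) ∧
      ∀ j, Q.con π' j = 1 / (T : ℝ) * ∑ t, Q.con (π t) j := by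
  have hT0 : (0 : ℝ) < T := by exact_mod_cast hT
  refine ⟨fun x => ∑ t, (1 / (T : ℝ)) • π t x, ⟨?_, fun x => ?_⟩, ?_, fun j => ?_⟩
  · exact Finset.measurable_sum _ fun t _ => (hπ t).1.const_smul (1 / (T : ℝ))
  · refine Q.S_convex.sum_mem (fun _ _ => by positivity) ?_ fun t _ => (hπ t).2 x
    simp [hT0.ne']
  · simp only [Problem.rew]
    rw [← integral_finsetSum _ fun t _ => Q.integrable_reward_of_mem (hπ t), ← integral_const_mul]
    refine integral_congr_ae (ae_of_all _ fun z => ?_)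
    simp only [dotProduct_sum, dotProduct_smul, smul_eq_mul, Finset.mul_sum]
  · simp only [Problem.con]
    rw [← integral_finsetSum _ fun t _ => Q.integrable_consume_of_mem (hπ t) j,
      ← integral_const_mul]
    refine integral_congr_ae (ae_of_all _ fun z => ?_)
    simp only [consume, Matrix.mulVec_sum, Matrix.mulVec_smul, Finset.sum_apply, Pi.smul_apply,
      smul_eq_mul, Finset.mul_sum]

/-! ### Runs of the algorithm -/

namespace Trajectory

variable {p d m : ℕ} {Q : Problem p d m} {M : Method Q} {A : Trajectory p d m} {T : ℕ}

/-- The pair of dual variables of round `t`. -/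
def dual (A : Trajectory p d m) (t : ℕ) (s : Fin t → Obs p d m) : Vec m × Vec m :=
  (A.lam t s, A.tht t s)

lemma measurable_dual (hA : A.IsRun M T) {t : ℕ} (ht : t ≤ T) : Measurable (A.dual t) :=
  (hA.lam_measurable t ht).prodMk (hA.tht_measurable t ht)

/-- After the start, membership is known only almost surely under the law of all `T` observations;
it descends to the law of the first `t` along `past`. -/
lemma dual_mem (hA : A.IsRun M T) {t : ℕ} (ht : t ≤ T) :
    ∀ᵐ s ∂(Measure.pi fun _ : Fin t => Q.P), A.dual t s ∈ Q.Lam ×ˢ Q.Tht := by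
  cases t with
  | zero => exact ae_of_all _ fun s => ⟨hA.lam_init s, hA.tht_init s⟩
  | succ k =>
    have hmp := measurePreserving_past Q.P ht
    rw [← hmp.map_eq, ae_map_iff hmp.measurable.aemeasurable
      (measurable_dual hA ht Q.measurableSet_dual)]
    filter_upwards [hA.lam_step ⟨k, ht⟩, hA.tht_step ⟨k, ht⟩] with z h1 h2
    obtain ⟨_, -, -, h1⟩ := h1
    obtain ⟨_, -, -, h2⟩ := h2
    exact ⟨h1.1, h2.1⟩

/-- The decision of round `t` as a function of the past and of the current context. -/
def roundPolicy (A : Trajectory p d m) (M : Method Q) (t : ℕ)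
    (q : (Fin t → Obs p d m) × Vec p) : Vec d :=
  M.oracle (A.pred M t q.1 q.2) (A.dual t q.1)

lemma measurable_roundPolicy (hA : A.IsRun M T) {t : ℕ} (ht : t < T) :
    Measurable (A.roundPolicy M t) :=
  M.oracle_measurable.comp ((hA.pred_measurable t ht).prodMk
    ((measurable_dual hA ht.le).comp measurable_fst))

lemma roundPolicy_mem (hA : A.IsRun M T) {t : ℕ} (ht : t < T) :
    ∀ᵐ s ∂(Measure.pi fun _ : Fin t => Q.P), ∀ x, A.roundPolicy M t (s, x) ∈ Q.S :=
  (dual_mem hA ht.le).mono fun s hs _ => (M.oracle_spec _ (A.dual t s) hs).1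

lemma integral_round {t : Fin T} {F : (Fin t → Obs p d m) × Obs p d m → ℝ}
    (hF : Integrable F ((Measure.pi fun _ => Q.P).prod Q.P)) :
    Integrable (fun z : Fin T → Obs p d m => F (past t.2.le z, z t))
      (Measure.pi fun _ : Fin T => Q.P) ∧
    ∫ z, F (past t.2.le z, z t) ∂(Measure.pi fun _ : Fin T => Q.P)
      = ∫ q, F q ∂((Measure.pi fun _ => Q.P).prod Q.P) := by
  have hmp := measurePreserving_past_eval Q.P t
  refine ⟨hmp.integrable_comp_of_integrable hF, ?_⟩
  have hF' := hF.aestronglyMeasurable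
  rw [← hmp.map_eq] at hF' ⊢
  rw [integral_map hmp.measurable.aemeasurable hF']

lemma integrable_reward (hA : A.IsRun M T) (t : Fin T) :
    Integrable (fun z : Fin T → Obs p d m => (z t).2.1 ⬝ᵥ A.decision M z t)
      (Measure.pi fun _ : Fin T => Q.P) :=
  (integral_round (t := t) (Q.integrable_reward (Measure.pi fun _ => Q.P)
    (measurable_roundPolicy hA t.2) (roundPolicy_mem hA t.2))).1

lemma integrable_consumption (hA : A.IsRun M T) (t : Fin T) (j : Fin m) :
    Integrable (fun z : Fin T → Obs p d m => A.consumption M z t j)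
      (Measure.pi fun _ : Fin T => Q.P) :=
  (integral_round (t := t) (Q.integrable_consume (Measure.pi fun _ => Q.P)
    (measurable_roundPolicy hA t.2) (roundPolicy_mem hA t.2) j)).1

lemma vAvg_apply (z : Fin T → Obs p d m) (j : Fin m) :
    A.vAvg M z j = 1 / (T : ℝ) * ∑ t, A.consumption M z t j := by
  simp [vAvg]

lemma integrable_rAvg (hA : A.IsRun M T) :
    Integrable (fun z : Fin T → Obs p d m => A.rAvg M z) (Measure.pi fun _ : Fin T => Q.P) :=
  (integrable_finsetSum _ fun t _ => integrable_reward hA t).const_mul _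

lemma integrable_vAvg (hA : A.IsRun M T) (j : Fin m) :
    Integrable (fun z : Fin T → Obs p d m => A.vAvg M z j) (Measure.pi fun _ : Fin T => Q.P) := by
  simp only [vAvg_apply]
  exact (integrable_finsetSum _ fun t _ => integrable_consumption hA t j).const_mul _

lemma integrable_u_vAvg (hA : A.IsRun M T) :
    Integrable (fun z : Fin T → Obs p d m => Q.u (A.vAvg M z))
      (Measure.pi fun _ : Fin T => Q.P) :=
  integrable_comp_lipschitz (integrable_vAvg hA) Q.nrm Q.u_lipschitz

lemma integrable_dist_vAvg (hA : A.IsRun M T) :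
    Integrable (fun z : Fin T → Obs p d m => Q.dist (A.vAvg M z))
      (Measure.pi fun _ : Fin T => Q.P) :=
  integrable_comp_lipschitz (integrable_vAvg hA) Q.nrm Q.dist_lipschitz

/-- The decisions of a run induce a static policy with the same expected average reward and
consumption. -/
lemma exists_static_policy (hA : A.IsRun M T) (hT : 1 ≤ T) :
    ∃ π ∈ Q.policies, Q.rew π = ∫ z, A.rAvg M z ∂(Measure.pi fun _ : Fin T => Q.P) ∧
      Q.con π = ∫ z, A.vAvg M z ∂(Measure.pi fun _ : Fin T => Q.P) := by
  have h : ∀ t : Fin T, ∃ π ∈ Q.policies,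
      Q.rew π = ∫ z : Fin T → Obs p d m, (z t).2.1 ⬝ᵥ A.decision M z t
        ∂(Measure.pi fun _ : Fin T => Q.P) ∧
      ∀ j, Q.con π j
        = ∫ z, A.consumption M z t j ∂(Measure.pi fun _ : Fin T => Q.P) := by
    intro t
    have hW := measurable_roundPolicy hA t.2
    have hS := roundPolicy_mem hA t.2
    obtain ⟨π, hπ, h1, h2⟩ := Q.exists_policy (Measure.pi fun _ => Q.P) hW hS
    refine ⟨π, hπ, h1.trans ?_, fun j => (h2 j).trans ?_⟩
    · exact (integral_round (t := t) (Q.integrable_reward _ hW hS)).2.symm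
    · exact (integral_round (t := t) (Q.integrable_consume _ hW hS j)).2.symm
  choose π hπ h1 h2 using h
  obtain ⟨π', hπ', e1, e2⟩ := Q.exists_mean_policy hT hπ
  refine ⟨π', hπ', ?_, ?_⟩
  · simp only [rAvg]
    rw [e1, integral_const_mul, integral_finsetSum _ fun t _ => integrable_reward hA t]
    simp only [h1]
  · ext j
    rw [e2, eval_integral fun i => integrable_vAvg hA i]
    simp only [vAvg_apply]
    rw [integral_const_mul, integral_finsetSum _ fun t _ => integrable_consumption hA t j]
    simp only [h2]

/-- The value of a run is at most the optimum relaxed by its expected distance to feasibility. -/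
lemma value_le_OPTrelax (hA : A.IsRun M T) (hT : 1 ≤ T) :
    ((∫ z, (A.rAvg M z + Q.u (A.vAvg M z)) ∂(Measure.pi fun _ : Fin T => Q.P) : ℝ) : EReal)
      ≤ Q.OPTrelax (∫ z, Q.dist (A.vAvg M z) ∂(Measure.pi fun _ : Fin T => Q.P)) := by
  obtain ⟨π, hπ, h1, h2⟩ := exists_static_policy hA hT
  have hv : Integrable (fun z : Fin T → Obs p d m => A.vAvg M z)
    (Measure.pi fun _ : Fin T => Q.P) := Integrable.of_eval (integrable_vAvg hA)
  -- Jensen's inequality for the convex distance, and below for the concave utility.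
  have hd : Q.dist (Q.con π) ≤ ∫ z, Q.dist (A.vAvg M z) ∂(Measure.pi fun _ : Fin T => Q.P) := by
    rw [h2]
    exact Q.dist_convexOn.map_integral_le Q.dist_continuous.continuousOn isClosed_univ
      (ae_of_all _ fun _ => Set.mem_univ _) hv (integrable_dist_vAvg hA)
  have hu : ∫ z, Q.u (A.vAvg M z) ∂(Measure.pi fun _ : Fin T => Q.P) ≤ Q.u (Q.con π) := by
    rw [h2]
    exact Q.u_concave.le_map_integral Q.u_continuous.continuousOn isClosed_univ
      (ae_of_all _ fun _ => Set.mem_univ _) hv (integrable_u_vAvg hA)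
  refine le_trans ?_ (le_iSup₂ (f := fun π (_ : π ∈ {π ∈ Q.policies | Q.dist (Q.con π) ≤
    ∫ z, Q.dist (A.vAvg M z) ∂(Measure.pi fun _ : Fin T => Q.P)}) =>
      ((Q.rew π + Q.u (Q.con π) : ℝ) : EReal)) π ⟨hπ, hd⟩)
  rw [EReal.coe_le_coe_iff, integral_add (integrable_rAvg hA) (integrable_u_vAvg hA), h1]
  linarith

/-- The dual updates have low regret along almost every run. -/
lemma pathwise_bound (hA : A.IsRun M T) (hT : 1 ≤ T) (a : Vec m) :
    ∀ᵐ z ∂(Measure.pi fun _ : Fin T => Q.P),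
      ∑ t : Fin T, (cost M.ζ (z t).2 (A.dual t (past t.2.le z)) ⬝ᵥ A.decision M z t
          + (A.dual t (past t.2.le z)).1 ⬝ᵥ a + M.ζ * ((A.dual t (past t.2.le z)).2 ⬝ᵥ a))
        + T * (Q.u a - M.ζ * Q.dist a)
      ≤ T * (A.rAvg M z + Q.u (A.vAvg M z)) - T * M.ζ * Q.dist (A.vAvg M z)
        + 3 / 2 * (M.GLam * √M.DLam + M.ζ * (M.GTht * √M.DTht)) * √(T : ℝ) := by
  have hT0 : (0 : ℝ) < T := by exact_mod_cast hT
  filter_upwards [ae_all_iff.2 hA.lam_step, ae_all_iff.2 hA.tht_step] with z hl ht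
  -- The value `0` beyond the horizon only makes the sequence total; it is never used.
  have h1 := mirror_regret_conj (f := fun v => -Q.u v) (y := fun t => if h : t ≤ T then
      A.lam t (past h z) else 0) (v := A.consumption M z)
    Q.u_concave.neg Q.u_continuous.neg Q.nrm_definite M.hLam_spec M.DLam_pos M.GLam_pos
    M.DLam_spec hT (by rw [dif_pos (Nat.zero_le T)]; exact hA.lam_init _) (fun t => by
      obtain ⟨q, hq⟩ := hl t
      refine ⟨q, ?_⟩
      simp only [dif_pos t.2.le, dif_pos (Nat.succ_le_of_lt t.2)]
      exact hq) a
  have h2 := mirror_regret_conj (f := Q.dist) (y := fun t => if h : t ≤ T then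
      A.tht t (past h z) else 0) (v := A.consumption M z)
    Q.dist_convexOn Q.dist_continuous Q.nrm_definite M.hTht_spec M.DTht_pos M.GTht_pos
    M.DTht_spec hT (by rw [dif_pos (Nat.zero_le T)]; exact hA.tht_init _) (fun t => by
      obtain ⟨q, hq⟩ := ht t
      refine ⟨q, ?_⟩
      simp only [dif_pos t.2.le, dif_pos (Nat.succ_le_of_lt t.2)]
      exact hq) a
  have e1 : ∀ t : Fin T, (if h : (t : ℕ) ≤ T then A.lam t (past h z) else 0)
      = (A.dual t (past t.2.le z)).1 := fun t => dif_pos t.2.le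
  have e2 : ∀ t : Fin T, (if h : (t : ℕ) ≤ T then A.tht t (past h z) else 0)
      = (A.dual t (past t.2.le z)).2 := fun t => dif_pos t.2.le
  simp only [e1] at h1
  simp only [e2] at h2
  -- Adding the dual terms at `a` turns the linear costs into rewards plus exactly the sums bounded
  -- by the two regret inequalities.
  have e3 : ∑ t : Fin T, (cost M.ζ (z t).2 (A.dual t (past t.2.le z)) ⬝ᵥ A.decision M z t
          + (A.dual t (past t.2.le z)).1 ⬝ᵥ a + M.ζ * ((A.dual t (past t.2.le z)).2 ⬝ᵥ a))
      = T * A.rAvg M z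
        + ∑ t : Fin T, (A.dual t (past t.2.le z)).1 ⬝ᵥ (a - A.consumption M z t)
        + M.ζ * ∑ t : Fin T, (A.dual t (past t.2.le z)).2 ⬝ᵥ (a - A.consumption M z t) := by
    rw [rAvg, ← mul_assoc, mul_one_div_cancel hT0.ne', one_mul, Finset.mul_sum,
      ← Finset.sum_add_distrib, ← Finset.sum_add_distrib]
    refine Finset.sum_congr rfl fun t _ => ?_
    rw [cost_dotProduct, dotProduct_sub, dotProduct_sub, consumption]
    ring
  have h3 := mul_le_mul_of_nonneg_left h2 M.ζ_pos.le
  rw [e3]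
  simp only [vAvg]
  linarith

/-- A bound on the expected excess risk in round `t`. -/
noncomputable def roundError (B κ α : ℝ) (t : ℕ) : ℝ := κ * (t : ℝ) ^ (-α) + if t = 0 then B else 0

lemma roundError_nonneg {B κ α : ℝ} (hB : 0 ≤ B) (hκ : 0 < κ) (t : ℕ) :
    0 ≤ roundError B κ α t := by
  unfold roundError
  split_ifs <;> positivity

lemma lintegral_excess_risk_le {B κ α : ℝ} (hκ : 0 < κ) (hM : M.RiskBound κ α)
    (hB : ∀ g : Vec p → Coeff d m, Measurable g →
      ∀ ω ∈ Q.Lam ×ˢ Q.Tht, M.spoRisk g ω - M.spoRisk Q.gstar ω ≤ B)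
    (hA : A.IsRun M T) {t : ℕ} (ht : t < T) :
    ∫⁻ s, ENNReal.ofReal (M.spoRisk (A.pred M t s) (A.dual t s) - M.spoRisk Q.gstar (A.dual t s))
        ∂(Measure.pi fun _ : Fin t => Q.P)
      ≤ ENNReal.ofReal (roundError B κ α t) := by
  cases t with
  | zero =>
    refine (lintegral_mono_ae (g := fun _ => ENNReal.ofReal B) ?_).trans ?_
    · filter_upwards [dual_mem hA (Nat.zero_le T)] with s hs
      -- `B` is uniform in the predictor and the dual variables, so the bound does not depend on the
      -- initialization.
      exact ENNReal.ofReal_le_ofReal (hB _ hA.g₀_measurable _ hs)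
    · simp only [lintegral_const, measure_univ, mul_one]
      refine ENNReal.ofReal_le_ofReal ?_
      simp only [roundError, if_true]
      have : 0 ≤ κ * ((0 : ℕ) : ℝ) ^ (-α) := by positivity
      linarith
  | succ k =>
    refine (lintegral_mono_ae ?_).trans ((hM (k + 1) k.succ_pos).trans ?_)
    -- The dual variables depend on the same sample as the predictor, hence the need for the
    -- supremum over `ω` inside the expectation.
    · filter_upwards [dual_mem hA ht.le] with s hs
      exact le_iSup₂ (f := fun ω (_ : ω ∈ Q.Lam ×ˢ Q.Tht) =>
        ENNReal.ofReal (M.spoRisk (M.erm (k + 1) s ω) ω - M.spoRisk Q.gstar ω)) _ hs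
    · simp [roundError]

/-- The penalized value of a run, compared to that of a static policy. -/
lemma lagrangian_bound {B κ α : ℝ} (hB0 : 0 ≤ B) (hκ : 0 < κ) (hM : M.RiskBound κ α)
    (hB : ∀ g : Vec p → Coeff d m, Measurable g →
      ∀ ω ∈ Q.Lam ×ˢ Q.Tht, M.spoRisk g ω - M.spoRisk Q.gstar ω ≤ B)
    (hA : A.IsRun M T) (hT : 1 ≤ T) {π : Vec p → Vec d} (hπ : π ∈ Q.policies) :
    Q.rew π + Q.u (Q.con π) - M.ζ * Q.dist (Q.con π)
      ≤ ∫ z, (A.rAvg M z + Q.u (A.vAvg M z)) ∂(Measure.pi fun _ : Fin T => Q.P)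
        - M.ζ * ∫ z, Q.dist (A.vAvg M z) ∂(Measure.pi fun _ : Fin T => Q.P)
        + (3 / 2 * (M.GLam * √M.DLam + M.ζ * (M.GTht * √M.DTht)) * √(T : ℝ)
          + ∑ t ∈ Finset.range T, roundError B κ α t) / T := by
  have hT0 : (0 : ℝ) < T := by exact_mod_cast hT
  have hround := fun t : Fin T => M.rew_le_round (Measure.pi fun _ : Fin t => Q.P)
    (measurable_dual hA t.2.le) (dual_mem hA t.2.le) (hA.pred_measurable t t.2)
    (roundError_nonneg (α := α) hB0 hκ t) (lintegral_excess_risk_le hκ hM hB hA t.2) hπ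
  have hint := fun t : Fin T => integral_round (t := t) (hround t).1
  set F : Fin T → (Fin T → Obs p d m) → ℝ := fun t z =>
    cost M.ζ (z t).2 (A.dual t (past t.2.le z)) ⬝ᵥ A.decision M z t
      + (A.dual t (past t.2.le z)).1 ⬝ᵥ Q.con π
      + M.ζ * ((A.dual t (past t.2.le z)).2 ⬝ᵥ Q.con π) with hF
  have hFi : ∀ t, Integrable (F t) (Measure.pi fun _ : Fin T => Q.P) := fun t => (hint t).1
  have hFle : ∀ t : Fin T, Q.rew π
      ≤ ∫ z, F t z ∂(Measure.pi fun _ : Fin T => Q.P) + roundError B κ α t := fun t =>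
    (hround t).2.trans (add_le_add_left (hint t).2.ge _)
  have hsum := Finset.sum_le_sum fun (t : Fin T) (_ : t ∈ Finset.univ) => hFle t
  rw [Finset.sum_const, Finset.card_univ, Fintype.card_fin, nsmul_eq_mul, Finset.sum_add_distrib,
    Fin.sum_univ_eq_sum_range (fun t => roundError B κ α t),
    ← integral_finsetSum _ fun t _ => hFi t] at hsum
  have hX := (integrable_rAvg hA).add (integrable_u_vAvg hA)
  have hD := integrable_dist_vAvg hA
  have hSi := integrable_finsetSum Finset.univ fun t _ => hFi t
  have hpath := integral_mono_ae (hSi.add (integrable_const _))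
    (((hX.const_mul (T : ℝ)).sub (hD.const_mul (T * M.ζ))).add (integrable_const _))
    (pathwise_bound hA hT (Q.con π))
  rw [integral_add' hSi (integrable_const _), integral_add' ((hX.const_mul (T : ℝ)).sub
    (hD.const_mul (T * M.ζ))) (integrable_const _), integral_sub' (hX.const_mul (T : ℝ))
    (hD.const_mul (T * M.ζ)), integral_const, integral_const] at hpath
  simp only [probReal_univ, one_smul, Pi.add_apply, integral_const_mul] at hpath
  rw [← sub_le_iff_le_add', le_div_iff₀ hT0]
  linarith

end Trajectory

/-! ### Rates -/

/-- Telescoping of `1/√(n+1) ≤ 2√(n+1) - 2√n`. The term `t = 0` vanishes, since `0` to a nonzero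
real power is `0`. -/
lemma sum_range_rpow_neg_half_le (T : ℕ) :
    ∑ t ∈ Finset.range T, (t : ℝ) ^ (-(1 / 2) : ℝ) ≤ 2 * √(T : ℝ) := by
  have key : ∀ n : ℕ, ∑ t ∈ Finset.range (n + 1), (t : ℝ) ^ (-(1 / 2) : ℝ) ≤ 2 * √(n : ℝ) := by
    intro n
    induction n with
    | zero => simp
    | succ n ih =>
      rw [Finset.sum_range_succ]
      have h1 : ((n + 1 : ℕ) : ℝ) ^ (-(1 / 2) : ℝ) = (√((n + 1 : ℕ) : ℝ))⁻¹ := by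
        rw [Real.rpow_neg (Nat.cast_nonneg _), ← Real.sqrt_eq_rpow]
      have h2 : 0 < √((n + 1 : ℕ) : ℝ) := Real.sqrt_pos.2 (by positivity)
      have h3 : √((n + 1 : ℕ) : ℝ) ^ 2 = n + 1 := by
        rw [Real.sq_sqrt (Nat.cast_nonneg _)]; push_cast; ring
      have h4 : √(n : ℝ) ^ 2 = n := Real.sq_sqrt (Nat.cast_nonneg _)
      have h5 : (√((n + 1 : ℕ) : ℝ))⁻¹ ≤ 2 * √((n + 1 : ℕ) : ℝ) - 2 * √(n : ℝ) := by
        rw [inv_le_iff_one_le_mul₀ h2]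
        nlinarith [sq_nonneg (√((n + 1 : ℕ) : ℝ) - √(n : ℝ))]
      rw [h1]
      linarith
  refine le_trans ?_ (key T)
  exact Finset.sum_le_sum_of_subset_of_nonneg (Finset.range_mono T.le_succ)
    fun t _ _ => by positivity

/-- Comparison with the exponent `1/2`, through `t^{1/2-α} ≤ T^{1/2-α}`. This keeps the constant
free of `α`, unlike the factor `1/(1-α)` of the integral test. -/
lemma sum_range_rpow_neg_le {α : ℝ} (h0 : 0 < α) (h : α ≤ 1 / 2) {T : ℕ} (hT : 1 ≤ T) :
    ∑ t ∈ Finset.range T, (t : ℝ) ^ (-α) ≤ 2 * (T : ℝ) ^ (-α) * T := by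
  have hT0 : (0 : ℝ) < T := by exact_mod_cast hT
  calc ∑ t ∈ Finset.range T, (t : ℝ) ^ (-α)
      ≤ ∑ t ∈ Finset.range T, (t : ℝ) ^ (-(1 / 2) : ℝ) * (T : ℝ) ^ (1 / 2 - α) := by
        refine Finset.sum_le_sum fun t ht => ?_
        rcases Nat.eq_zero_or_pos t with rfl | hpos
        · rw [Nat.cast_zero, Real.zero_rpow (by linarith)]
          positivity
        have ht0 : (0 : ℝ) < t := by exact_mod_cast hpos
        have e : -α = -(1 / 2) + (1 / 2 - α) := by ring
        rw [e, Real.rpow_add ht0]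
        have : (t : ℝ) ≤ T := by exact_mod_cast (Finset.mem_range.1 ht).le
        have : (t : ℝ) ^ (1 / 2 - α) ≤ (T : ℝ) ^ (1 / 2 - α) :=
          Real.rpow_le_rpow ht0.le this (by linarith)
        gcongr
    _ ≤ 2 * √(T : ℝ) * (T : ℝ) ^ (1 / 2 - α) := by
        rw [← Finset.sum_mul]
        have := sum_range_rpow_neg_half_le T
        gcongr
    _ = 2 * (T : ℝ) ^ (-α) * T := by
        rw [Real.sqrt_eq_rpow, mul_assoc, mul_assoc, ← Real.rpow_add hT0]
        conv_rhs => rw [← Real.rpow_one (T : ℝ), ← Real.rpow_mul hT0.le, ← Real.rpow_add hT0]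
        congr 2
        ring

lemma rpow_neg_half_mul {T : ℕ} (hT : 1 ≤ T) : (T : ℝ) ^ (-(1 / 2) : ℝ) * T = √(T : ℝ) := by
  have hT0 : (0 : ℝ) < T := by exact_mod_cast hT
  rw [Real.sqrt_eq_rpow]
  nth_rw 2 [← Real.rpow_one (T : ℝ)]
  rw [← Real.rpow_add hT0]
  norm_num

/-- Termwise `t^{-α} = o(t^{-1/2})`, and this passes to partial sums because the series of
`t^{-1/2}` diverges. -/
lemma eventually_sum_rpow_neg_le {α ε : ℝ} (h : 1 / 2 < α) (hε : 0 < ε) :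
    ∀ᶠ T : ℕ in atTop, ∑ t ∈ Finset.range T, (t : ℝ) ^ (-α) ≤ ε * √(T : ℝ) := by
  have h1 : (fun t : ℕ => (t : ℝ) ^ (-α)) =o[atTop] fun t : ℕ => (t : ℝ) ^ (-(1 / 2) : ℝ) := by
    have hz : ∀ᶠ t : ℕ in atTop, (t : ℝ) ^ (-(1 / 2) : ℝ) = 0 → (t : ℝ) ^ (-α) = 0 := by
      filter_upwards [eventually_gt_atTop 0] with t ht h
      exact absurd h (Real.rpow_pos_of_pos (Nat.cast_pos.2 ht) _).ne'
    rw [Asymptotics.isLittleO_iff_tendsto' hz]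
    refine ((tendsto_rpow_neg_atTop (show 0 < α - 1 / 2 by linarith)).comp
      tendsto_natCast_atTop_atTop).congr' ?_
    filter_upwards [eventually_gt_atTop 0] with t ht
    rw [Function.comp_apply, ← Real.rpow_sub (Nat.cast_pos.2 ht)]
    ring_nf
  have h2 := h1.sum_range (fun t => by positivity) <| by
    refine (not_summable_iff_tendsto_nat_atTop_of_nonneg fun t => by positivity).1 ?_
    rw [Real.summable_nat_rpow]
    norm_num
  filter_upwards [h2.bound (half_pos hε)] with T hT
  have h3 := sum_range_rpow_neg_half_le T
  rw [Real.norm_of_nonneg (Finset.sum_nonneg fun t _ => by positivity),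
    Real.norm_of_nonneg (Finset.sum_nonneg fun t _ => by positivity)] at hT
  nlinarith

/-- For `α ≤ 1/2` the sum has order `T^{1-α}` with an absolute constant; for `α > 1/2` it is
eventually below `k√T`. So is `B`, and the factor `2` is universal while the threshold on `T`
depends on the data. -/
lemma eventually_roundError_le {B κ α k : ℝ} (hκ : 0 < κ) (hα : 0 < α) (hk : 0 < k) :
    ∀ᶠ T : ℕ in atTop, (∑ t ∈ Finset.range T, Trajectory.roundError B κ α t) / T
      ≤ 2 * (k * (T : ℝ) ^ (-(1 / 2) : ℝ) + κ * (T : ℝ) ^ (-α)) := by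
  have hsqrt : Tendsto (fun T : ℕ => √(T : ℝ)) atTop atTop :=
    Real.tendsto_sqrt_atTop.comp tendsto_natCast_atTop_atTop
  have hsum : ∀ᶠ T : ℕ in atTop, κ * ∑ t ∈ Finset.range T, (t : ℝ) ^ (-α)
      ≤ k * √(T : ℝ) + 2 * (κ * (T : ℝ) ^ (-α) * T) := by
    rcases le_or_gt α (1 / 2) with h | h
    · filter_upwards [eventually_ge_atTop 1] with T hT
      have h1 := mul_le_mul_of_nonneg_left (sum_range_rpow_neg_le hα h hT) hκ.le
      have h2 : 0 ≤ k * √(T : ℝ) := by positivity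
      linarith
    · filter_upwards [eventually_sum_rpow_neg_le h (div_pos hk hκ)] with T hT
      have h1 := mul_le_mul_of_nonneg_left hT hκ.le
      have h2 : κ * (k / κ * √(T : ℝ)) = k * √(T : ℝ) := by field_simp
      have h3 : 0 ≤ 2 * (κ * (T : ℝ) ^ (-α) * T) := by positivity
      linarith
  filter_upwards [hsum, hsqrt.eventually_ge_atTop (B / k), eventually_ge_atTop 1] with T h1 h2 hT
  have hT0 : (0 : ℝ) < T := by exact_mod_cast hT
  have h3 : ∑ t ∈ Finset.range T, Trajectory.roundError B κ α t
      = κ * ∑ t ∈ Finset.range T, (t : ℝ) ^ (-α) + B := by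
    simp only [Trajectory.roundError, Finset.sum_add_distrib, ← Finset.mul_sum]
    rw [Finset.sum_ite_eq' (Finset.range T) 0 fun _ => B, if_pos (Finset.mem_range.2 hT)]
  rw [div_le_iff₀' hk] at h2
  have h4 := rpow_neg_half_mul hT
  rw [h3, div_le_iff₀ hT0, mul_assoc, add_mul, mul_assoc k, h4]
  linarith

end OnlineSPO

/-! ### Combining the Lagrangian bound, the relaxation bound and the rates -/

theorem theorem2 (K : ℝ) :
    ∃ C : ℝ, 0 < C ∧
      ∀ (p d m : ℕ) (Q : OnlineSPO.Problem p d m) (M : OnlineSPO.Method Q) (Dv κ α ζopt : ℝ),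
        0 < κ → 0 < α →
        M.RiskBound κ α →
        OnlineSPO.BoundedConsumption Q Dv →
        OnlineSPO.RelaxBound Q ζopt →
        M.GLam ≤ K * Dv → M.GTht ≤ K * Dv →
        ∃ c : ℕ → ℝ, (∀ᶠ T in atTop, c T ≤ C) ∧
          ∀ T : ℕ, 1 ≤ T → ∀ A : OnlineSPO.Trajectory p d m, A.IsRun M T →
            (Q.OPT - ((∫ z, (A.rAvg M z + Q.u (A.vAvg M z))
                    ∂(Measure.pi fun _ : Fin T => Q.P) : ℝ) : EReal)
                ≤ ((OnlineSPO.kappaMD M Dv * (c T * (T : ℝ) ^ (-(1 / 2) : ℝ))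
                    + κ * (c T * (T : ℝ) ^ (-α)) : ℝ) : EReal)) ∧
            (2 * (ζopt + √M.DLam / √M.DTht + κ / (Dv * √M.DTht)) ≤ M.ζ →
              ∫ z, Q.dist (A.vAvg M z) ∂(Measure.pi fun _ : Fin T => Q.P)
                ≤ Dv * √M.DTht * (c T * (T : ℝ) ^ (-(1 / 2) : ℝ))
                    + Dv * √M.DTht * (c T * (T : ℝ) ^ (-α))) := by
  -- Twice `3/2 |K| + 2`: the first term comes from the mirror descent regret, the second from the
  -- prediction error.
  refine ⟨3 * |K| + 4, by positivity, ?_⟩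
  intro p d m Q M Dv κ α ζopt hκ hα hM hD hrelax hGL hGT
  obtain ⟨B, hB0, hB⟩ := M.exists_excess_risk_bound
  have hDv : 0 < Dv := one_pos.trans_le hD.1
  have hζ := M.ζ_pos
  have hGL0 := M.GLam_pos
  have hGT0 := M.GTht_pos
  have hsL : 0 < √M.DLam := Real.sqrt_pos.2 M.DLam_pos
  have hsT : 0 < √M.DTht := Real.sqrt_pos.2 M.DTht_pos
  have hk : 0 < OnlineSPO.kappaMD M Dv := by unfold OnlineSPO.kappaMD; positivity
  set R : ℝ := 3 / 2 * (M.GLam * √M.DLam + M.ζ * (M.GTht * √M.DTht)) with hR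
  have hR0 : 0 < R := by positivity
  have hRle : R ≤ 3 / 2 * |K| * OnlineSPO.kappaMD M Dv := by
    have h1 : M.GLam ≤ |K| * Dv := hGL.trans (by gcongr; exact le_abs_self K)
    have h2 : M.GTht ≤ |K| * Dv := hGT.trans (by gcongr; exact le_abs_self K)
    calc R ≤ 3 / 2 * (|K| * Dv * √M.DLam + M.ζ * (|K| * Dv * √M.DTht)) := by rw [hR]; gcongr
      _ = _ := by unfold OnlineSPO.kappaMD; ring
  set err : ℕ → ℝ := fun T =>
    (R * √(T : ℝ) + ∑ t ∈ Finset.range T, OnlineSPO.Trajectory.roundError B κ α t) / T with herr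
  set den : ℕ → ℝ := fun T =>
    OnlineSPO.kappaMD M Dv * (T : ℝ) ^ (-(1 / 2) : ℝ) + κ * (T : ℝ) ^ (-α) with hden
  have hden0 : ∀ T, 1 ≤ T → 0 < den T := by
    intro T hT
    have hT0 : (0 : ℝ) < T := by exact_mod_cast hT
    simp only [hden]
    positivity
  have herr0 : ∀ T, 0 ≤ err T := by
    intro T
    have := Finset.sum_nonneg fun (t : ℕ) (_ : t ∈ Finset.range T) =>
      OnlineSPO.Trajectory.roundError_nonneg (α := α) hB0 hκ t
    simp only [herr]
    positivity
  -- Without the factor `2` the first claim would already follow; the second needs it because only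
  -- `ζ/2` of the penalty remains after subtracting `ζopt`.
  refine ⟨fun T => 2 * (err T / den T), ?_, ?_⟩
  · filter_upwards [OnlineSPO.eventually_roundError_le (B := B) hκ hα hk,
      eventually_ge_atTop 1] with T h hT
    have hT0 : (0 : ℝ) < T := by exact_mod_cast hT
    have h1 : err T ≤ (3 / 2 * |K| + 2) * den T := by
      have h2 : R * √(T : ℝ) / T = R * (T : ℝ) ^ (-(1 / 2) : ℝ) := by
        rw [← OnlineSPO.rpow_neg_half_mul hT]
        field_simp
      have h3 : R * (T : ℝ) ^ (-(1 / 2) : ℝ)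
          ≤ 3 / 2 * |K| * OnlineSPO.kappaMD M Dv * (T : ℝ) ^ (-(1 / 2) : ℝ) := by gcongr
      have h4 : 0 ≤ 3 / 2 * |K| * (κ * (T : ℝ) ^ (-α)) := by positivity
      simp only [herr, hden]
      rw [add_div, h2]
      linarith
    have := (div_le_iff₀ (hden0 T hT)).2 h1
    linarith
  intro T hT A hA
  set X := ∫ z, (A.rAvg M z + Q.u (A.vAvg M z)) ∂(Measure.pi fun _ : Fin T => Q.P)
  set ε := ∫ z, Q.dist (A.vAvg M z) ∂(Measure.pi fun _ : Fin T => Q.P) with hε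
  have hε0 : 0 ≤ ε := integral_nonneg fun z => Q.dist_nonneg _
  have hOPT : Q.OPT ≤ ((X - M.ζ * ε + err T : ℝ) : EReal) := by
    refine iSup₂_le fun π hπ => ?_
    rw [EReal.coe_le_coe_iff]
    have h1 := OnlineSPO.Trajectory.lagrangian_bound hB0 hκ hM hB hA hT hπ.1
    have h2 : Q.dist (Q.con π) = 0 := OnlineSPO.distTo_eq_zero Q.nrm hπ.2
    rw [h2, mul_zero, sub_zero] at h1
    exact h1
  set c := 2 * (err T / den T) with hc
  have hc0 : 0 ≤ c := mul_nonneg two_pos.le (div_nonneg (herr0 T) (hden0 T hT).le)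
  have hcerr : err T = c / 2 * den T := by
    have := (hden0 T hT).ne'
    rw [hc]
    field_simp
  constructor
  · refine EReal.sub_le_of_le_add (hOPT.trans ?_)
    rw [← EReal.coe_add, EReal.coe_le_coe_iff]
    have h1 : 0 ≤ M.ζ * ε := by positivity
    have h2 : 0 ≤ c / 2 * den T := hcerr ▸ herr0 T
    simp only [hden] at hcerr h2
    linarith
  · intro hζ2
    have hT0 : (0 : ℝ) < T := by exact_mod_cast hT
    -- `RelaxBound` speaks only of positive `ε`.
    rcases hε0.eq_or_lt with h0 | hpos
    · rw [← h0]
      positivity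
    -- Chaining both comparisons with `OPT` eliminates it, and `X` cancels: `(ζ - ζopt) ε ≤ err T`.
    have h1 : ((X : ℝ) : EReal) ≤ ((X - M.ζ * ε + err T + ζopt * ε : ℝ) : EReal) := by
      refine (OnlineSPO.Trajectory.value_le_OPTrelax hA hT).trans ((hrelax ε hpos).trans ?_)
      rw [EReal.coe_add]
      exact add_le_add_left hOPT _
    rw [EReal.coe_le_coe_iff, hcerr] at h1
    set a := √M.DLam / √M.DTht with ha
    set s := Dv * √M.DTht with hs
    set b := κ / s with hb
    have hs0 : 0 < s := by positivity
    have ha0 : 0 < a := by positivity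
    have hb0 : 0 < b := by positivity
    have e1 : OnlineSPO.kappaMD M Dv = s * (M.ζ + a) := by
      rw [OnlineSPO.kappaMD, ha, hs]
      field_simp
    have e2 : κ = s * b := by rw [hb]; field_simp
    set x := (T : ℝ) ^ (-(1 / 2) : ℝ)
    set y := (T : ℝ) ^ (-α)
    have hx : 0 < x := by positivity
    have hy : 0 < y := by positivity
    have e3 : den T = s * (M.ζ + a) * x + s * b * y := by
      simp only [hden]
      rw [e1, ← e2]
    -- The condition on `ζ` says `ζopt + a + b ≤ ζ/2`.
    have h2 : ε * (M.ζ / 2 + a + b) ≤ ε * (M.ζ - ζopt) := by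
      gcongr
      linarith
    -- In units of `s`, half the coefficients of `den T` are `(ζ + a)/2` and `b/2`, both at most
    -- `ζ/2 + a + b`; that common factor is cancelled at the end.
    have h3 : c / 2 * den T ≤ (s * (c * x) + s * (c * y)) * (M.ζ / 2 + a + b) := by
      rw [e3]
      have h4 : 0 ≤ c * s * x * (a / 2 + b) := by positivity
      have h5 : 0 ≤ c * s * y * (M.ζ / 2 + a + b / 2) := by positivity
      linarith
    refine le_of_mul_le_mul_right (?_ : ε * (M.ζ / 2 + a + b) ≤ _) (by positivity)
    linarith
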